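/- For a finite set $A$ and a word $r\in (A\cup A^{-1})^*$ let $\langle A\mid r=1\rangle$ be the corresponding one-relator group. A submonoid $M$ of $\langle A\mid r=1\rangle$ is called a \emph{Magnus submonoid} (with respect to this presentation) if it is generated by (the images of) a subset $X\subseteq A\cup A^{-1}$ such that for some letter $a\in A$ appearing in $r$ (that is, $a$ or $a^{-1}$ is a letter of $r$) one has $\{a,a^{-1}\}\not\subseteq X$. Membership in $M$ is \emph{decidable} if there is an algorithm that, given a word $u\in (A\cup A^{-1})^*$, decides whether the element of $\langle A\mid r=1\rangle$ represented by $u$ belongs to $M$. Theorem. Let $g\ge 0$ be an integer (for $g=0$ there are no Magnus submonoids, so nothing is claimed). Membership in every Magnus submonoid of the orientable surface group $$S_g=\langle a_1,\dots,a_g,b_1,\dots,b_g \mid [a_1,b_1]\cdots[a_g,b_g]=1\rangle,\qquad [a,b]=aba^{-1}b^{-1},$$ is decidable, and membership in every Magnus submonoid of the non-orientable surface group $$\mathcal N_g=\langle a_1,\dots,a_g\mid a_1^2\cdots a_g^2=1\rangle$$ is decidable. -/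

import Mathlib

/-- Words over `A ∪ A⁻¹`: the letter `(a, true)` stands for `a` and `(a, false)` for `a⁻¹`. -/
abbrev GroupWord (A : Type) : Type := List (A × Bool)

/-- The one-relator group `⟨A | r = 1⟩` of a word `r` over `A ∪ A⁻¹`. -/
abbrev OneRelatorGroup {A : Type} (r : GroupWord A) : Type :=
  PresentedGroup {FreeGroup.mk r}

namespace OneRelatorGroup

/-- The element of `⟨A | r = 1⟩` that a word over `A ∪ A⁻¹` represents. -/
def ofWord {A : Type} (r : GroupWord A) (u : GroupWord A) : OneRelatorGroup r :=
  PresentedGroup.mk {FreeGroup.mk r} (FreeGroup.mk u)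

/-- The letter `a` appears in the word `r`: at least one of `a`, `a⁻¹` is a letter of `r`. -/
def Appears {A : Type} (a : A) (r : GroupWord A) : Prop :=
  (a, true) ∈ r ∨ (a, false) ∈ r

/-- `M` is a Magnus submonoid of `⟨A | r = 1⟩`: it is generated by a set `X` of letters from
`A ∪ A⁻¹` such that for some letter `a` appearing in `r`, `{a, a⁻¹}` is not contained in `X`. -/
def IsMagnusSubmonoid {A : Type} (r : GroupWord A) (M : Submonoid (OneRelatorGroup r)) : Prop :=
  ∃ X : Set (A × Bool),
    (∃ a : A, Appears a r ∧ ¬ ({(a, true), (a, false)} : Set (A × Bool)) ⊆ X) ∧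
      M = Submonoid.closure ((fun x : A × Bool => ofWord r [x]) '' X)

/-- Membership in `M` is decidable: some algorithm decides, given a word `u` over `A ∪ A⁻¹`,
whether the element that `u` represents lies in `M`. -/
def DecidableMembership {A : Type} [Primcodable A] (r : GroupWord A)
    (M : Submonoid (OneRelatorGroup r)) : Prop :=
  ComputablePred fun u : GroupWord A => ofWord r u ∈ M

end OneRelatorGroup

/-- The word `[a₁, b₁] ⋯ [a_g, b_g]`, where `[a, b] = a b a⁻¹ b⁻¹`, `Sum.inl i` is the generator
`a_i` and `Sum.inr i` is the generator `b_i`. -/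
def orientableSurfaceRelator (g : ℕ) : GroupWord (Fin g ⊕ Fin g) :=
  (List.finRange g).flatMap fun i =>
    [(Sum.inl i, true), (Sum.inr i, true), (Sum.inl i, false), (Sum.inr i, false)]

/-- The word `a₁² ⋯ a_g²`. -/
def nonorientableSurfaceRelator (g : ℕ) : GroupWord (Fin g) :=
  (List.finRange g).flatMap fun i => [(i, true), (i, true)]

/-- The orientable surface group `S_g = ⟨a₁, …, a_g, b₁, …, b_g | [a₁, b₁] ⋯ [a_g, b_g] = 1⟩`. -/
abbrev OrientableSurfaceGroup (g : ℕ) : Type :=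
  OneRelatorGroup (orientableSurfaceRelator g)

/-- The non-orientable surface group `N_g = ⟨a₁, …, a_g | a₁² ⋯ a_g² = 1⟩`. -/
abbrev NonorientableSurfaceGroup (g : ℕ) : Type :=
  OneRelatorGroup (nonorientableSurfaceRelator g)

/-! A generating set `X` of a Magnus submonoid misses `a` or `a⁻¹` for some generator `a`. A cyclic
rotation of the relator isolates `a`. In the orientable case it says `t s t⁻¹ = p s`, where `t = a`,
`s` is the other generator of the same handle, and `p` contains every remaining letter, of either
sign, exactly once; this gives an HNN extension of a free group with infinite cyclic associated
subgroups. In the nonorientable case it says that `a` or `a⁻¹`, whichever may still lie in `X`, is a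
square root of a word `z` in the other generators, all with one sign; this is an amalgam of a free
group with a cyclic group. `StableData` and `Realizes` treat both at once.

By Britton's lemma, two reduced sequences for one element differ only by powers of the cyclic
subgroups moved across the stable letters. An element of the submonoid has a reduced sequence with
all entries in a submonoid `N` of the free group, so membership asks whether the computed normal
form can be shifted into `N` (`Shiftable`). Apart from membership in `N`, the only infinite search
is over the exponents of the shifts. If `N` avoids a letter `x` that occurs in the shifting words,
the occurrences of `x` in a shift must cancel against the given entries, so the exponents are at
most the total length (`Shiftable.bounded`). In the remaining cases `N` contains all the shifts
(`Shiftable.zero`), no stable letter is available, or the submonoid is the whole group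
(`closure_eq_top_of_ofWord_eq_one`).

In the square root case `N` must contain `z`, the square of the stable letter; membership in `N` is
then read off reduced words (`exists_primrec_mem_adjoinWord`). -/

set_option linter.unusedSectionVars false

/-! ### Computable operations on words of a free group. -/

section FreeGroupWords

variable {A : Type}

theorem Primrec.freeGroup_reduce [DecidableEq A] [Primcodable A] :
    Primrec (FreeGroup.reduce : GroupWord A → GroupWord A) := by
  have hstep : Primrec₂ fun (_ : GroupWord A) (p : (A × Bool) × GroupWord A) =>
      (List.casesOn p.2 [p.1] fun hd tl =>
        if p.1.1 = hd.1 ∧ p.1.2 = !hd.2 then tl else p.1 :: hd :: tl : GroupWord A) := by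
    refine Primrec.list_casesOn (f := fun q : GroupWord A × ((A × Bool) × GroupWord A) => q.2.2)
      (g := fun q => [q.2.1])
      (h := fun q r => if q.2.1.1 = r.1.1 ∧ q.2.1.2 = !r.1.2 then r.2 else q.2.1 :: r.1 :: r.2)
      (Primrec.snd.comp Primrec.snd)
      (Primrec.list_cons.comp (Primrec.fst.comp Primrec.snd) (Primrec.const [])) ?_
    have hx : Primrec fun q : (GroupWord A × ((A × Bool) × GroupWord A)) ×
        ((A × Bool) × GroupWord A) => q.1.2.1 :=
      Primrec.fst.comp (Primrec.snd.comp Primrec.fst)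
    have hy : Primrec fun q : (GroupWord A × ((A × Bool) × GroupWord A)) ×
        ((A × Bool) × GroupWord A) => q.2.1 := Primrec.fst.comp Primrec.snd
    refine Primrec.ite (PrimrecPred.and ?_ ?_) (Primrec.snd.comp Primrec.snd)
      (Primrec.list_cons.comp hx
        (Primrec.list_cons.comp hy (Primrec.snd.comp Primrec.snd)))
    · exact Primrec.eq.comp (Primrec.fst.comp hx) (Primrec.fst.comp hy)
    · exact Primrec.eq.comp (Primrec.snd.comp hx)
        (Primrec.not.comp (Primrec.snd.comp hy))
  refine (Primrec.list_foldr (Primrec.id (α := GroupWord A)) (Primrec.const []) hstep).of_eq ?_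
  intro l
  induction l with
  | nil => rfl
  | cons x l ih =>
    simp only [id_eq] at ih
    simp only [id_eq, List.foldr_cons, ih, FreeGroup.reduce.cons]

theorem Primrec.freeGroup_invRev [Primcodable A] :
    Primrec (FreeGroup.invRev : GroupWord A → GroupWord A) :=
  Primrec.list_reverse.comp (Primrec.list_map Primrec.id
    (Primrec.pair (Primrec.fst.comp Primrec.snd)
      (Primrec.not.comp (Primrec.snd.comp Primrec.snd))))

/-- The word `z ⋯ z` with `n` factors. -/
def wordPow (n : ℕ) (z : GroupWord A) : GroupWord A := (List.range n).flatMap fun _ => z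

theorem wordPow_succ (n : ℕ) (z : GroupWord A) : wordPow (n + 1) z = wordPow n z ++ z := by
  simp [wordPow, List.range_succ, List.flatMap_append]

theorem Primrec.wordPow [Primcodable A] : Primrec₂ (wordPow : ℕ → GroupWord A → GroupWord A) :=
  Primrec.list_flatMap (Primrec.list_range.comp Primrec.fst)
    (Primrec.snd.comp Primrec.fst)

theorem mk_wordPow (n : ℕ) (z : GroupWord A) :
    FreeGroup.mk (wordPow n z) = FreeGroup.mk z ^ n := by
  induction n with
  | zero => rfl
  | succ n ih => rw [wordPow_succ, ← FreeGroup.mul_mk, ih, pow_succ]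

theorem length_wordPow (n : ℕ) (z : GroupWord A) : (wordPow n z).length = n * z.length := by
  simp [wordPow]

/-- The pairs of words that represent `(zⁿ, z'ⁿ)` for the integers `n` with `|n| ≤ B`. -/
def powerPairs (z z' : GroupWord A) (B : ℕ) : List (GroupWord A × GroupWord A) :=
  (List.range (B + 1)).flatMap fun n =>
    [(wordPow n z, wordPow n z'),
      (wordPow n (FreeGroup.invRev z), wordPow n (FreeGroup.invRev z'))]

theorem Primrec.powerPairs [Primcodable A] {α : Type} [Primcodable α] {z z' : α → GroupWord A}
    {B : α → ℕ} (hz : Primrec z) (hz' : Primrec z') (hB : Primrec B) :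
    Primrec fun a => powerPairs (z a) (z' a) (B a) := by
  refine Primrec.list_flatMap (Primrec.list_range.comp (Primrec.succ.comp hB)) ?_
  have h : ∀ {f : α → GroupWord A}, Primrec f →
      Primrec fun p : α × ℕ => _root_.wordPow p.2 (f p.1) :=
    fun hf => Primrec.wordPow.comp Primrec.snd (hf.comp Primrec.fst)
  refine Primrec.list_cons.comp (Primrec.pair (h hz) (h hz')) (Primrec.list_cons.comp
    (Primrec.pair (h (Primrec.freeGroup_invRev.comp hz)) (h (Primrec.freeGroup_invRev.comp hz')))
    (Primrec.const []))

theorem exists_mem_powerPairs (z z' : GroupWord A) {B : ℕ} {n : ℤ} (hn : n.natAbs ≤ B) :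
    ∃ q ∈ powerPairs z z' B,
      FreeGroup.mk q.1 = FreeGroup.mk z ^ n ∧ FreeGroup.mk q.2 = FreeGroup.mk z' ^ n := by
  obtain ⟨m, rfl | rfl⟩ := n.eq_nat_or_neg
  · refine ⟨(wordPow m z, wordPow m z'), ?_, ?_⟩
    · refine List.mem_flatMap.2 ⟨m, List.mem_range.2 (by omega), by simp⟩
    · simp [mk_wordPow]
  · refine ⟨(wordPow m (FreeGroup.invRev z), wordPow m (FreeGroup.invRev z')), ?_, ?_⟩
    · refine List.mem_flatMap.2 ⟨m, List.mem_range.2 (by omega), by simp⟩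
    · simp [mk_wordPow, ← FreeGroup.inv_mk]

theorem exists_zpow_of_mem_powerPairs {z z' : GroupWord A} {B : ℕ} {q : GroupWord A × GroupWord A}
    (hq : q ∈ powerPairs z z' B) :
    ∃ n : ℤ, n.natAbs ≤ B ∧
      FreeGroup.mk q.1 = FreeGroup.mk z ^ n ∧ FreeGroup.mk q.2 = FreeGroup.mk z' ^ n := by
  obtain ⟨m, hm, hq⟩ := List.mem_flatMap.1 hq
  have hm := List.mem_range.1 hm
  simp only [List.mem_cons, List.not_mem_nil, or_false] at hq
  rcases hq with rfl | rfl
  · exact ⟨m, by simp; omega, by simp [mk_wordPow]⟩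
  · exact ⟨-m, by simp; omega, by simp [mk_wordPow, ← FreeGroup.inv_mk]⟩

end FreeGroupWords

/-! ### Normal forms with stable letters, and the decision procedure. -/

/-- The combinatorial data of a group generated by a free group on `A` and by elements `τ e`,
`e ∈ E`, such that `τ e * dom e = cod e * τ e` and `τ e * τ (opp e) = fold e`. A letter is either a
generator of the free group or, when `letter` sends it to `(q, e)`, the product of `q` and `τ e`. -/
structure StableData (A E : Type) where
  letter : A × Bool → Option (GroupWord A × E)
  dom : E → GroupWord A
  cod : E → GroupWord A
  opp : E → E
  fold : E → GroupWord A

namespace StableData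

variable {A E : Type} [DecidableEq A] [DecidableEq E] (S : StableData A E)

/-- A word `w'` for `codⁿ` when the word `g` represents `domⁿ`. -/
def pinchWord (e : E) (g : GroupWord A) : Option (GroupWord A) :=
  ((powerPairs (S.dom e) (S.cod e) g.length).filterMap fun q =>
    if FreeGroup.reduce q.1 = FreeGroup.reduce g then some q.2 else none).head?

/-- Left multiplication of a normal form by `τ e`. -/
def pushStable (e : E) (s : GroupWord A × List (E × GroupWord A)) :
    GroupWord A × List (E × GroupWord A) :=
  List.casesOn s.2 ([], [(e, s.1)]) fun p T =>
    if p.1 = S.opp e then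
      Option.casesOn (S.pinchWord e s.1) ([], (e, s.1) :: p :: T)
        fun c => (c ++ S.fold e ++ p.2, T)
    else ([], (e, s.1) :: p :: T)

/-- Left multiplication of a normal form by a letter. -/
def pushLetter (x : A × Bool) (s : GroupWord A × List (E × GroupWord A)) :
    GroupWord A × List (E × GroupWord A) :=
  Option.casesOn (S.letter x) (x :: s.1, s.2)
    fun qe => (qe.1 ++ (S.pushStable qe.2 s).1, (S.pushStable qe.2 s).2)

/-- The normal form of a word. -/
def normalForm (u : GroupWord A) : GroupWord A × List (E × GroupWord A) :=
  u.foldr S.pushLetter ([], [])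

/-- The words `codⁿ`, `|n| ≤ B`, such that `dom⁻ⁿ * g * c` satisfies `L` for some `c` in `C`. -/
def admissible (L : GroupWord A → Bool) (P : E → Bool) (B : ℕ) (p : E × GroupWord A)
    (C : List (GroupWord A)) : List (GroupWord A) :=
  if P p.1 = true then
    (powerPairs (S.dom p.1) (S.cod p.1) B).filterMap fun q =>
      if ∃ c ∈ C, L (FreeGroup.reduce (FreeGroup.invRev q.1 ++ p.2 ++ c)) = true
      then some q.2 else none
  else []

/-- The total length of the words in a normal form. -/
def totalLength (s : GroupWord A × List (E × GroupWord A)) : ℕ :=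
  s.2.foldr (fun p n => p.2.length + n) s.1.length

/-- The decision procedure on normal forms. -/
def Accepts (L : GroupWord A → Bool) (P : E → Bool)
    (s : GroupWord A × List (E × GroupWord A)) : Prop :=
  ∃ c ∈ s.2.foldr (S.admissible L P (totalLength s)) [[]],
    L (FreeGroup.reduce (s.1 ++ c)) = true

section Primrec

variable [Primcodable A] [Primcodable E] [Finite E]

theorem primrec_pinchWord : Primrec₂ S.pinchWord := by
  refine Primrec.list_head?.comp (Primrec.listFilterMap (Primrec.powerPairs
    ((Primrec.dom_finite S.dom).comp Primrec.fst) ((Primrec.dom_finite S.cod).comp Primrec.fst)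
    (Primrec.list_length.comp Primrec.snd)) ?_)
  refine Primrec.ite (Primrec.eq.comp (Primrec.freeGroup_reduce.comp ?_)
    (Primrec.freeGroup_reduce.comp ?_)) (Primrec.option_some.comp ?_) (Primrec.const none)
  · exact Primrec.fst.comp Primrec.snd
  · exact Primrec.snd.comp Primrec.fst
  · exact Primrec.snd.comp Primrec.snd

theorem primrec_pushStable : Primrec₂ S.pushStable := by
  have hcons : Primrec fun q : (E × (GroupWord A × List (E × GroupWord A))) ×
      ((E × GroupWord A) × List (E × GroupWord A)) =>
        (([], (q.1.1, q.1.2.1) :: q.2.1 :: q.2.2) : GroupWord A × List (E × GroupWord A)) := by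
    refine Primrec.pair (Primrec.const []) (Primrec.list_cons.comp (Primrec.pair
      (Primrec.fst.comp Primrec.fst) (Primrec.fst.comp (Primrec.snd.comp Primrec.fst)))
      (Primrec.list_cons.comp (Primrec.fst.comp Primrec.snd) (Primrec.snd.comp Primrec.snd)))
  refine Primrec.list_casesOn
    (f := fun q : E × (GroupWord A × List (E × GroupWord A)) => q.2.2)
    (g := fun q => (([], [(q.1, q.2.1)]) : GroupWord A × List (E × GroupWord A)))
    (h := fun q r => if r.1.1 = S.opp q.1 then
      Option.casesOn (S.pinchWord q.1 q.2.1) ([], (q.1, q.2.1) :: r.1 :: r.2)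
        fun c => (c ++ S.fold q.1 ++ r.1.2, r.2)
      else ([], (q.1, q.2.1) :: r.1 :: r.2))
    (Primrec.snd.comp Primrec.snd) (Primrec.pair (Primrec.const [])
    (Primrec.list_cons.comp (Primrec.pair Primrec.fst (Primrec.fst.comp Primrec.snd))
      (Primrec.const []))) ?_
  refine Primrec.ite (Primrec.eq.comp (Primrec.fst.comp (Primrec.fst.comp Primrec.snd))
    ((Primrec.dom_finite S.opp).comp (Primrec.fst.comp Primrec.fst))) ?_ hcons
  refine Primrec.option_casesOn (S.primrec_pinchWord.comp (Primrec.fst.comp Primrec.fst)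
    (Primrec.fst.comp (Primrec.snd.comp Primrec.fst))) hcons ?_
  refine Primrec.pair (Primrec.list_append.comp (Primrec.list_append.comp Primrec.snd
    ((Primrec.dom_finite S.fold).comp (Primrec.fst.comp (Primrec.fst.comp Primrec.fst)))) ?_) ?_
  · exact Primrec.snd.comp (Primrec.fst.comp (Primrec.snd.comp Primrec.fst))
  · exact Primrec.snd.comp (Primrec.snd.comp Primrec.fst)

theorem primrec_pushLetter [Finite A] : Primrec₂ S.pushLetter := by
  have h : Primrec fun q : ((A × Bool) × (GroupWord A × List (E × GroupWord A))) ×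
      (GroupWord A × E) => S.pushStable q.2.2 q.1.2 :=
    S.primrec_pushStable.comp (Primrec.snd.comp Primrec.snd) (Primrec.snd.comp Primrec.fst)
  refine Primrec.option_casesOn ((Primrec.dom_finite S.letter).comp Primrec.fst)
    (Primrec.pair (Primrec.list_cons.comp Primrec.fst (Primrec.fst.comp Primrec.snd))
      (Primrec.snd.comp Primrec.snd)) ?_
  exact Primrec.pair (Primrec.list_append.comp (Primrec.fst.comp Primrec.snd)
    (Primrec.fst.comp h)) (Primrec.snd.comp h)

theorem primrec_normalForm [Finite A] : Primrec S.normalForm :=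
  Primrec.list_foldr Primrec.id (Primrec.const ([], []))
    ((S.primrec_pushLetter.comp (Primrec.fst.comp Primrec.snd) (Primrec.snd.comp Primrec.snd)).to₂)

theorem primrec_admissible {L : GroupWord A → Bool} (hL : Primrec L) (P : E → Bool) :
    Primrec fun q : ℕ × ((E × GroupWord A) × List (GroupWord A)) =>
      S.admissible L P q.1 q.2.1 q.2.2 := by
  have hp : Primrec fun q : ℕ × ((E × GroupWord A) × List (GroupWord A)) => q.2.1 :=
    Primrec.fst.comp Primrec.snd
  have he := Primrec.fst.comp hp
  refine Primrec.ite (Primrec.eq.comp ((Primrec.dom_finite P).comp he) (Primrec.const true)) ?_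
    (Primrec.const [])
  refine Primrec.listFilterMap (Primrec.powerPairs ((Primrec.dom_finite S.dom).comp he)
    ((Primrec.dom_finite S.cod).comp he) Primrec.fst) ?_
  refine Primrec.ite ?_ (Primrec.option_some.comp (Primrec.snd.comp Primrec.snd))
    (Primrec.const none)
  have hR : PrimrecRel fun (c : GroupWord A) (r : GroupWord A) =>
      L (FreeGroup.reduce (r ++ c)) = true :=
    Primrec.eq.comp (hL.comp (Primrec.freeGroup_reduce.comp
      (Primrec.list_append.comp Primrec.snd Primrec.fst))) (Primrec.const true)
  refine hR.exists_mem_list.comp (Primrec.snd.comp (Primrec.snd.comp Primrec.fst))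
    (Primrec.list_append.comp (Primrec.freeGroup_invRev.comp (Primrec.fst.comp Primrec.snd)) ?_)
  exact Primrec.snd.comp (hp.comp Primrec.fst)

theorem primrec_totalLength :
    Primrec (totalLength : GroupWord A × List (E × GroupWord A) → ℕ) :=
  Primrec.list_foldr Primrec.snd (Primrec.list_length.comp Primrec.fst)
    ((Primrec.nat_add.comp (Primrec.list_length.comp
      (Primrec.snd.comp (Primrec.fst.comp Primrec.snd))) (Primrec.snd.comp Primrec.snd)).to₂)

theorem primrecPred_accepts {L : GroupWord A → Bool} (hL : Primrec L) (P : E → Bool) :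
    PrimrecPred (S.Accepts L P) := by
  have hR : PrimrecRel fun (c : GroupWord A) (r : GroupWord A) =>
      L (FreeGroup.reduce (r ++ c)) = true :=
    Primrec.eq.comp (hL.comp (Primrec.freeGroup_reduce.comp
      (Primrec.list_append.comp Primrec.snd Primrec.fst))) (Primrec.const true)
  refine hR.exists_mem_list.comp (Primrec.list_foldr
    (h := fun s q => S.admissible L P (totalLength s) q.1 q.2)
    Primrec.snd (Primrec.const [[]]) ?_) Primrec.fst
  exact ((S.primrec_admissible hL P).comp (Primrec.pair
    (primrec_totalLength.comp Primrec.fst) Primrec.snd)).to₂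

end Primrec

end StableData

/-! ### Correctness of normal forms and of the procedure, from Britton's lemma. -/

namespace StableData

variable {A E : Type} [DecidableEq A] [DecidableEq E] (S : StableData A E)
  {H : Type} [Group H] (β : FreeGroup A →* H) (τ : E → H)

/-- The element `β g * τ e₁ * β g₁ * ⋯ * τ eₖ * β gₖ`. -/
def eval (g : FreeGroup A) (l : List (E × FreeGroup A)) : H :=
  β g * (l.map fun p => τ p.1 * β p.2).prod

/-- The sequence of elements of the free group that a normal form represents. -/
def entries (l : List (E × GroupWord A)) : List (E × FreeGroup A) :=
  l.map fun p => (p.1, FreeGroup.mk p.2)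

/-- No factor `τ e * β g * τ (opp e)` has `g` in the subgroup generated by `dom e`. -/
def Reduced (l : List (E × FreeGroup A)) : Prop :=
  l.IsChain fun p p' => p'.1 = S.opp p.1 → p.2 ∉ Subgroup.zpowers (FreeGroup.mk (S.dom p.1))

/-- The element of `H` that a letter stands for. -/
def letterValue (x : A × Bool) : H :=
  Option.casesOn (S.letter x) (β (FreeGroup.mk [x])) fun qe => β (FreeGroup.mk qe.1) * τ qe.2

/-- The relations of `StableData` hold in `H`, and reduced sequences that represent the same
element differ as little as possible. -/
structure Realizes : Prop where
  conj (e : E) : τ e * β (FreeGroup.mk (S.dom e)) = β (FreeGroup.mk (S.cod e)) * τ e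
  mul_opp (e : E) : τ e * τ (S.opp e) = β (FreeGroup.mk (S.fold e))
  -- The bound on the exponent makes the search for a pinch finite.
  exists_zpow (e : E) (g : FreeGroup A) : g ∈ Subgroup.zpowers (FreeGroup.mk (S.dom e)) →
    ∃ n : ℤ, n.natAbs ≤ g.norm ∧ FreeGroup.mk (S.dom e) ^ n = g
  britton (g g' : FreeGroup A) (l l' : List (E × FreeGroup A)) :
    S.Reduced l → S.Reduced l' → eval β τ g l = eval β τ g' l' →
      l.map Prod.fst = l'.map Prod.fst ∧ (l = [] → g = g') ∧
        ∀ e ∈ (l.map Prod.fst).head?, g⁻¹ * g' ∈ Subgroup.zpowers (FreeGroup.mk (S.cod e))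

variable {S β τ}

theorem eval_cons (g : FreeGroup A) (p : E × FreeGroup A) (l : List (E × FreeGroup A)) :
    eval β τ g (p :: l) = β g * τ p.1 * eval β τ p.2 l := by
  simp [eval, mul_assoc]

theorem eval_mul (g g' : FreeGroup A) (l : List (E × FreeGroup A)) :
    eval β τ (g * g') l = β g * eval β τ g' l := by
  simp [eval, mul_assoc]

theorem Realizes.conj_zpow (hS : S.Realizes β τ) (e : E) (n : ℤ) :
    τ e * β (FreeGroup.mk (S.dom e) ^ n) = β (FreeGroup.mk (S.cod e) ^ n) * τ e := by
  have h : SemiconjBy (τ e) (β (FreeGroup.mk (S.dom e))) (β (FreeGroup.mk (S.cod e))) := hS.conj e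
  simpa only [map_zpow] using (h.zpow_right n).eq

theorem Realizes.stable_mul_eval_pinch (hS : S.Realizes β τ) {e : E} {g : FreeGroup A} {n : ℤ}
    (hn : FreeGroup.mk (S.dom e) ^ n = g) (g' : FreeGroup A) (l : List (E × FreeGroup A)) :
    τ e * eval β τ g ((S.opp e, g') :: l) =
      eval β τ (FreeGroup.mk (S.cod e) ^ n * FreeGroup.mk (S.fold e) * g') l := by
  rw [eval_cons, eval_mul, map_mul, ← hS.mul_opp, ← hn]
  simp only [← mul_assoc, hS.conj_zpow]

/-- The search is exhaustive: by `exists_zpow` an exponent never has to exceed the norm of the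
element, hence the length of the word. -/
theorem Realizes.pinchWord_spec (hS : S.Realizes β τ) (e : E) (g : GroupWord A) :
    (∃ n : ℤ, ∃ c, S.pinchWord e g = some c ∧ FreeGroup.mk (S.dom e) ^ n = FreeGroup.mk g ∧
      FreeGroup.mk c = FreeGroup.mk (S.cod e) ^ n) ∨
    (S.pinchWord e g = none ∧
      FreeGroup.mk g ∉ Subgroup.zpowers (FreeGroup.mk (S.dom e))) := by
  rcases h : S.pinchWord e g with _ | c
  · refine Or.inr ⟨rfl, fun hg => ?_⟩
    obtain ⟨n, hn, hng⟩ := hS.exists_zpow e _ hg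
    obtain ⟨q, hq, hq1, -⟩ := exists_mem_powerPairs (S.dom e) (S.cod e)
      (hn.trans FreeGroup.norm_mk_le)
    rw [pinchWord, List.head?_eq_none_iff, List.filterMap_eq_nil_iff] at h
    have := h q hq
    rw [if_pos (FreeGroup.reduce.sound (hq1.trans hng))] at this
    cases this
  · have h' := List.mem_of_head? h
    obtain ⟨q, hq, hqc⟩ := List.mem_filterMap.1 h'
    split_ifs at hqc with hr
    obtain ⟨n, -, h1, h2⟩ := exists_zpow_of_mem_powerPairs hq
    cases hqc
    exact Or.inl ⟨n, q.2, rfl, h1 ▸ FreeGroup.reduce.exact hr, h2⟩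

theorem Realizes.eval_pushStable (hS : S.Realizes β τ) (e : E)
    (s : GroupWord A × List (E × GroupWord A)) :
    eval β τ (FreeGroup.mk (S.pushStable e s).1) (entries (S.pushStable e s).2) =
      τ e * eval β τ (FreeGroup.mk s.1) (entries s.2) := by
  have hpush : ∀ (g : GroupWord A) (l : List (E × GroupWord A)),
      eval β τ (FreeGroup.mk []) (entries ((e, g) :: l)) =
        τ e * eval β τ (FreeGroup.mk g) (entries l) := by
    intro g l
    simp [entries, eval_cons, ← FreeGroup.one_eq_mk]
  obtain ⟨g, _ | ⟨⟨e', g'⟩, T⟩⟩ := s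
  · exact hpush g []
  · simp only [pushStable]
    split_ifs with he
    · rcases hS.pinchWord_spec e g with ⟨n, c, hc, hn, hc'⟩ | ⟨hc, -⟩
      · subst he
        simp only [hc]
        refine Eq.trans ?_ (hS.stable_mul_eval_pinch hn (FreeGroup.mk g') (entries T)).symm
        rw [← FreeGroup.mul_mk, ← FreeGroup.mul_mk, hc']
      · simp only [hc]
        exact hpush g _
    · exact hpush g _

theorem Realizes.reduced_pushStable (hS : S.Realizes β τ) (e : E)
    (s : GroupWord A × List (E × GroupWord A)) (hs : S.Reduced (entries s.2)) :
    S.Reduced (entries (S.pushStable e s).2) := by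
  obtain ⟨g, _ | ⟨⟨e', g'⟩, T⟩⟩ := s
  · exact List.isChain_singleton _
  · simp only [pushStable]
    split_ifs with he
    · rcases hS.pinchWord_spec e g with ⟨n, c, hc, hn, hc'⟩ | ⟨hc, hg⟩
      · simp only [hc]
        exact List.IsChain.tail hs
      · simp only [hc]
        exact List.isChain_cons_cons.2 ⟨fun _ => hg, hs⟩
    · exact List.isChain_cons_cons.2 ⟨fun h => absurd h he, hs⟩

theorem Realizes.eval_normalForm (hS : S.Realizes β τ) (u : GroupWord A) :
    eval β τ (FreeGroup.mk (S.normalForm u).1) (entries (S.normalForm u).2) =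
      (u.map (S.letterValue β τ)).prod := by
  induction u with
  | nil => simp [normalForm, eval, entries, ← FreeGroup.one_eq_mk]
  | cons x u ih =>
    rw [List.map_cons, List.prod_cons, ← ih]
    change eval β τ (FreeGroup.mk (S.pushLetter x (S.normalForm u)).1)
      (entries (S.pushLetter x (S.normalForm u)).2) = _
    rw [pushLetter, letterValue]
    rcases S.letter x with _ | qe
    · change eval β τ (FreeGroup.mk (x :: _)) _ = _
      rw [← List.singleton_append, ← FreeGroup.mul_mk, eval_mul]
    · change eval β τ (FreeGroup.mk (_ ++ _)) _ = _
      rw [← FreeGroup.mul_mk, eval_mul, hS.eval_pushStable, mul_assoc]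

theorem Realizes.reduced_normalForm (hS : S.Realizes β τ) (u : GroupWord A) :
    S.Reduced (entries (S.normalForm u).2) := by
  induction u with
  | nil => exact List.isChain_nil
  | cons x u ih =>
    change S.Reduced (entries (S.pushLetter x (S.normalForm u)).2)
    rw [pushLetter]
    rcases S.letter x with _ | qe
    · exact ih
    · exact hS.reduced_pushStable _ _ ih

variable (S) in
/-- The sequence can be shifted, by powers of `dom` and `cod` with exponents in `R`, to one with all
its entries in `N`. -/
def Shiftable (N : Submonoid (FreeGroup A)) (P : E → Bool) (R : E → ℤ → Prop) :
    FreeGroup A → List (E × FreeGroup A) → Prop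
  | h, [] => h ∈ N
  | h, p :: l => P p.1 = true ∧ ∃ m : ℤ, R p.1 m ∧ h * FreeGroup.mk (S.cod p.1) ^ m ∈ N ∧
      Shiftable N P R (FreeGroup.mk (S.dom p.1) ^ (-m) * p.2) l

variable {N : Submonoid (FreeGroup A)} {P : E → Bool}

theorem Shiftable.mono {R R' : E → ℤ → Prop} (hR : ∀ e m, P e = true → R e m → R' e m) :
    ∀ {h : FreeGroup A} {l : List (E × FreeGroup A)},
      S.Shiftable N P R h l → S.Shiftable N P R' h l
  | _, [], hs => hs
  | _, _ :: _, ⟨hP, m, hm, hN, hs⟩ => ⟨hP, m, hR _ _ hP hm, hN, hs.mono hR⟩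

/-- By Britton's lemma the leading entries differ by a power of `cod e`. Moved across `τ e` it
becomes a power of `dom e`, which corrects the next entry, and the comparison continues with shorter
sequences. -/
theorem Realizes.shiftable_of_eval_eq (hS : S.Realizes β τ) :
    ∀ {l l' : List (E × FreeGroup A)} {h y : FreeGroup A}, S.Reduced l → S.Reduced l' → y ∈ N →
      (∀ p ∈ l', P p.1 = true ∧ p.2 ∈ N) → eval β τ h l = eval β τ y l' →
      S.Shiftable N P (fun _ _ => True) h l
  | [], l', h, y, hl, hl', hy, _, heq => by
    rw [Shiftable, (hS.britton h y [] l' hl hl' heq).2.1 rfl]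
    exact hy
  | p :: l, [], h, y, hl, hl', hy, _, heq => by
    have := (hS.britton h y _ _ hl hl' heq).1
    simp at this
  | ⟨e, g⟩ :: l, ⟨e', y'⟩ :: l', h, y, hl, hl', hy, hall, heq => by
    obtain ⟨h1, -, h2⟩ := hS.britton h y _ _ hl hl' heq
    obtain rfl : e = e' := by simpa using (List.cons.inj h1).1
    obtain ⟨m, hm⟩ := h2 e (by simp)
    have hy' : y = h * FreeGroup.mk (S.cod e) ^ m := by
      simp only at hm
      rw [hm, mul_inv_cancel_left]
    have hp := hall _ List.mem_cons_self
    refine ⟨hp.1, m, trivial, hy' ▸ hy, ?_⟩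
    refine hS.shiftable_of_eval_eq hl.tail hl'.tail hp.2
      (fun p hp => hall p (List.mem_cons_of_mem _ hp)) ?_
    rw [eval_cons, eval_cons, hy', map_mul, mul_assoc, mul_assoc, mul_assoc, mul_right_inj,
      ← mul_assoc, ← hS.conj_zpow, mul_assoc, mul_right_inj] at heq
    rw [eval_mul, heq, zpow_neg, map_inv, inv_mul_cancel_left]
    rfl

/-- A shift inserts `codᵐ` before a stable letter and `dom⁻ᵐ` after it, so the element does not
change, while the shifted factors visibly lie in `M`. -/
theorem Realizes.eval_mem_of_shiftable (hS : S.Realizes β τ) {M : Submonoid H}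
    (hN : ∀ y ∈ N, β y ∈ M) (hP : ∀ e, P e = true → τ e ∈ M) {R : E → ℤ → Prop} :
    ∀ {l : List (E × FreeGroup A)} {h : FreeGroup A},
      S.Shiftable N P R h l → eval β τ h l ∈ M
  | [], h, hs => by simpa [eval] using hN h hs
  | p :: l, h, ⟨hp, m, _, hm, hs⟩ => by
    have := M.mul_mem (M.mul_mem (hN _ hm) (hP _ hp)) (hS.eval_mem_of_shiftable hN hP hs)
    rwa [eval_mul, map_mul, mul_assoc (β h), ← hS.conj_zpow, zpow_neg, map_inv, ← mul_assoc,
      ← mul_assoc, mul_inv_cancel_right, ← eval_cons] at this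

/-- Elements of the submonoid generated by letters have reduced sequences with entries in `N`. -/
theorem Realizes.exists_reduced_of_mem_closure (hS : S.Realizes β τ) {X : Set (A × Bool)}
    (hbase : ∀ x ∈ X, S.letter x = none → FreeGroup.mk [x] ∈ N)
    (hstable : ∀ x ∈ X, ∀ q e, S.letter x = some (q, e) → q = [] ∧ P e = true)
    (hopp : ∀ e, P e = true → P (S.opp e) = true → ∀ n : ℤ, FreeGroup.mk (S.dom e) ^ n ∈ N →
      FreeGroup.mk (S.cod e) ^ n * FreeGroup.mk (S.fold e) ∈ N)
    {h : H} (hh : h ∈ Submonoid.closure (S.letterValue β τ '' X)) :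
    ∃ y l, S.Reduced l ∧ y ∈ N ∧ (∀ p ∈ l, P p.1 = true ∧ p.2 ∈ N) ∧ eval β τ y l = h := by
  induction hh using Submonoid.closure_induction_left with
  | one => exact ⟨1, [], List.isChain_nil, N.one_mem, by simp, by simp [eval]⟩
  | mul_left h hx h' _ ih =>
    obtain ⟨x, hx, rfl⟩ := hx
    obtain ⟨y, l, hl, hy, hall, rfl⟩ := ih
    rcases hxl : S.letter x with _ | ⟨q, e⟩
    · refine ⟨FreeGroup.mk [x] * y, l, hl, N.mul_mem (hbase x hx hxl) hy, hall, ?_⟩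
      rw [eval_mul, letterValue, hxl]
    · obtain ⟨rfl, he⟩ := hstable x hx q e hxl
      have hval : S.letterValue β τ x = τ e := by
        rw [letterValue, hxl]
        simp [← FreeGroup.one_eq_mk]
      have hpush : S.Reduced ((e, y) :: l) → ∃ y' l', S.Reduced l' ∧ y' ∈ N ∧
          (∀ p ∈ l', P p.1 = true ∧ p.2 ∈ N) ∧
          eval β τ y' l' = S.letterValue β τ x * eval β τ y l := by
        intro hred
        refine ⟨1, (e, y) :: l, hred, N.one_mem, ?_, by simp [eval_cons, hval]⟩
        simpa [he, hy] using hall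
      rcases l with _ | ⟨⟨e', y'⟩, l⟩
      · exact hpush (List.isChain_singleton _)
      -- A new stable letter can create a pinch only at the front. Its removal multiplies the
      -- following entry by `codⁿ * fold`, which is in `N` by `hopp`.
      · by_cases hpinch : e' = S.opp e ∧ y ∈ Subgroup.zpowers (FreeGroup.mk (S.dom e))
        · obtain ⟨rfl, n, hn⟩ := hpinch
          have hp := hall _ List.mem_cons_self
          refine ⟨_, l, hl.tail, N.mul_mem (hopp e he hp.1 n (by simpa [hn] using hy)) hp.2,
            fun p hp => hall p (List.mem_cons_of_mem _ hp), ?_⟩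
          rw [hval, hS.stable_mul_eval_pinch hn]
        · exact hpush (List.isChain_cons_cons.2 ⟨fun h1 h2 => hpinch ⟨h1, h2⟩, hl⟩)

/-- The fold works from the last entry to the first. What lies to the right of an entry matters only
through the finite list of corrections that it allows on that entry; the last entry allows only the
empty one. -/
theorem exists_mem_admissible_iff {L : GroupWord A → Bool}
    (hL : ∀ w, L (FreeGroup.reduce w) = true ↔ FreeGroup.mk w ∈ N) (B : ℕ)
    (l : List (E × GroupWord A)) (h : FreeGroup A) :
    (∃ c ∈ l.foldr (S.admissible L P B) [[]], h * FreeGroup.mk c ∈ N) ↔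
      S.Shiftable N P (fun _ m => m.natAbs ≤ B) h (entries l) := by
  induction l generalizing h with
  | nil => simp [entries, Shiftable, ← FreeGroup.one_eq_mk]
  | cons p l ih =>
    change _ ↔ P p.1 = true ∧ ∃ m : ℤ, m.natAbs ≤ B ∧ _ ∧
      S.Shiftable N P _ (_ * FreeGroup.mk p.2) (entries l)
    simp only [List.foldr_cons, admissible, ← ih]
    by_cases hP : P p.1 = true
    · simp only [hP, if_true, List.mem_filterMap, true_and]
      constructor
      · rintro ⟨c, ⟨q, hq, hqc⟩, hc⟩
        split_ifs at hqc with hex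
        obtain ⟨c', hc', hL'⟩ := hex
        obtain ⟨m, hm, h1, h2⟩ := exists_zpow_of_mem_powerPairs hq
        cases hqc
        refine ⟨m, hm, h2 ▸ hc, c', hc', ?_⟩
        rw [hL, ← FreeGroup.mul_mk, ← FreeGroup.mul_mk, ← FreeGroup.inv_mk, h1] at hL'
        rwa [zpow_neg]
      · rintro ⟨m, hm, hN, c', hc', hN'⟩
        obtain ⟨q, hq, h1, h2⟩ := exists_mem_powerPairs (S.dom p.1) (S.cod p.1) hm
        refine ⟨q.2, ⟨q, hq, if_pos ⟨c', hc', ?_⟩⟩, h2 ▸ hN⟩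
        rw [hL, ← FreeGroup.mul_mk, ← FreeGroup.mul_mk, ← FreeGroup.inv_mk, h1]
        rwa [zpow_neg] at hN'
    · simp [hP]

theorem accepts_iff {L : GroupWord A → Bool}
    (hL : ∀ w, L (FreeGroup.reduce w) = true ↔ FreeGroup.mk w ∈ N)
    (s : GroupWord A × List (E × GroupWord A)) :
    S.Accepts L P s ↔
      S.Shiftable N P (fun _ m => m.natAbs ≤ totalLength s) (FreeGroup.mk s.1) (entries s.2) := by
  rw [← exists_mem_admissible_iff hL]
  simp only [Accepts, hL, ← FreeGroup.mul_mk]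

/-- The total length of the entries of a sequence. -/
def totalNorm (l : List (E × FreeGroup A)) : ℕ := (l.map fun p => p.2.norm).sum

theorem norm_add_totalNorm_le (s : GroupWord A × List (E × GroupWord A)) :
    (FreeGroup.mk s.1).norm + totalNorm (entries s.2) ≤ totalLength s := by
  obtain ⟨g, l⟩ := s
  induction l with
  | nil => simpa [totalNorm, entries, totalLength] using FreeGroup.norm_mk_le
  | cons p l ih =>
    have := FreeGroup.norm_mk_le (L₁ := p.2)
    simp only [totalNorm, entries, totalLength, List.map_cons, List.sum_cons, List.foldr_cons]
      at ih ⊢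
    omega

/-- Decidability of membership in a submonoid of a group with `StableData`. -/
theorem Realizes.primrecPred_mem_closure [Primcodable A] [Primcodable E] [Finite A] [Finite E]
    (hS : S.Realizes β τ) {X : Set (A × Bool)}
    (hbase : ∀ x ∈ X, S.letter x = none → FreeGroup.mk [x] ∈ N)
    (hstable : ∀ x ∈ X, ∀ q e, S.letter x = some (q, e) → q = [] ∧ P e = true)
    (hopp : ∀ e, P e = true → P (S.opp e) = true → ∀ n : ℤ, FreeGroup.mk (S.dom e) ^ n ∈ N →
      FreeGroup.mk (S.cod e) ^ n * FreeGroup.mk (S.fold e) ∈ N)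
    (hN : ∀ y ∈ N, β y ∈ Submonoid.closure (S.letterValue β τ '' X))
    (hP : ∀ e, P e = true → τ e ∈ Submonoid.closure (S.letterValue β τ '' X))
    (hbound : ∀ h l B, h.norm + totalNorm l ≤ B → S.Shiftable N P (fun _ _ => True) h l →
      S.Shiftable N P (fun _ m => m.natAbs ≤ B) h l)
    {L : GroupWord A → Bool} (hLp : Primrec L)
    (hL : ∀ w, L (FreeGroup.reduce w) = true ↔ FreeGroup.mk w ∈ N) :
    PrimrecPred fun u : GroupWord A =>
      (u.map (S.letterValue β τ)).prod ∈ Submonoid.closure (S.letterValue β τ '' X) := by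
  refine ((S.primrecPred_accepts hLp P).comp S.primrec_normalForm).of_eq fun u => ?_
  rw [accepts_iff hL, ← hS.eval_normalForm]
  refine ⟨hS.eval_mem_of_shiftable hN hP, fun hu => ?_⟩
  obtain ⟨y, l, hl, hy, hall, heq⟩ := hS.exists_reduced_of_mem_closure hbase hstable hopp hu
  -- Britton's lemma gives shifts with no control on the exponents; `hbound` replaces them by shifts
  -- within the range of the search.
  exact hbound _ _ _ (norm_add_totalNorm_le _)
    (hS.shiftable_of_eval_eq (hS.reduced_normalForm u) hl hy hall heq.symm)

end StableData

/-! ### Counting a letter in reduced words. -/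

section LetterCount

variable {A : Type} [DecidableEq A]

/-- The number of occurrences of a letter in the reduced word of an element of the free group. -/
def letterCount (x : A × Bool) (g : FreeGroup A) : ℕ := g.toWord.count x

theorem letterCount_mk_le (x : A × Bool) (w : GroupWord A) :
    letterCount x (FreeGroup.mk w) ≤ w.count x := by
  rw [letterCount, FreeGroup.toWord_mk]
  exact (FreeGroup.reduce.red.sublist).count_le x

theorem letterCount_one (x : A × Bool) : letterCount x (1 : FreeGroup A) = 0 := by
  simp [letterCount]

theorem letterCount_mul_le (x : A × Bool) (g h : FreeGroup A) :
    letterCount x (g * h) ≤ letterCount x g + letterCount x h := by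
  rw [letterCount, letterCount, letterCount, ← List.count_append]
  exact (FreeGroup.toWord_mul_sublist g h).count_le x

theorem letterCount_le_norm (x : A × Bool) (g : FreeGroup A) : letterCount x g ≤ g.norm :=
  List.count_le_length

theorem letterCount_eq_zero_of_mem_closure {x : A × Bool} {G : Set (FreeGroup A)}
    (hG : ∀ g ∈ G, letterCount x g = 0) {g : FreeGroup A} (hg : g ∈ Submonoid.closure G) :
    letterCount x g = 0 := by
  induction hg using Submonoid.closure_induction with
  | mem g hg => exact hG g hg
  | one => exact letterCount_one x
  | mul g h _ _ ihg ihh => have := letterCount_mul_le x g h; omega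

theorem count_wordPow (n : ℕ) (z : GroupWord A) (x : A × Bool) :
    (wordPow n z).count x = n * z.count x := by
  induction n with
  | zero => simp [wordPow]
  | succ n ih => rw [wordPow_succ, List.count_append, ih, Nat.succ_mul]

theorem count_invRev (w : GroupWord A) (x : A × Bool) :
    (FreeGroup.invRev w).count x = w.count (x.1, !x.2) := by
  induction w with
  | nil => rfl
  | cons y w ih =>
    obtain ⟨y, b⟩ := y
    obtain ⟨x, c⟩ := x
    rw [FreeGroup.invRev_cons, List.count_append, ih, List.count_cons]
    simp only [FreeGroup.invRev, List.map_cons, List.map_nil, List.reverse_singleton,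
      List.count_singleton]
    cases b <;> cases c <;> simp [add_comm]

/-- All the powers of the word `z` are freely reduced. -/
def PowersReduced (z : GroupWord A) : Prop := ∀ n, FreeGroup.IsReduced (wordPow n z)

theorem PowersReduced.letterCount_pow {z : GroupWord A} (hz : PowersReduced z) (x : A × Bool)
    (n : ℕ) : letterCount x (FreeGroup.mk z ^ n) = n * z.count x := by
  rw [← mk_wordPow, letterCount, FreeGroup.toWord_mk, (hz n).reduce_eq, count_wordPow]

/-- No cancellation occurs in powers of `z`, and a negative power reads `z` backwards with inverted
letters. One of the two terms always vanishes. -/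
theorem PowersReduced.letterCount_zpow {z : GroupWord A} (hz : PowersReduced z) (x : A × Bool)
    (n : ℤ) : letterCount x (FreeGroup.mk z ^ n) =
      n.toNat * z.count x + (-n).toNat * z.count (x.1, !x.2) := by
  obtain ⟨m, rfl | rfl⟩ := n.eq_nat_or_neg
  · rw [zpow_natCast, hz.letterCount_pow]
    simp
  · have h : letterCount x (FreeGroup.mk z ^ (-(m : ℤ))) =
        letterCount (x.1, !x.2) (FreeGroup.mk z ^ m) := by
      rw [zpow_neg, zpow_natCast, letterCount, FreeGroup.toWord_inv, count_invRev, letterCount]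
    rw [h, hz.letterCount_pow]
    simp

theorem PowersReduced.natAbs_le_norm_zpow {z : GroupWord A} (hz : PowersReduced z) (hne : z ≠ [])
    (n : ℤ) : n.natAbs ≤ (FreeGroup.mk z ^ n).norm := by
  obtain ⟨x, hx⟩ := List.exists_mem_of_ne_nil z hne
  have hpos : 1 ≤ z.count x := List.count_pos_iff.2 hx
  have hpow : ∀ m : ℕ, m ≤ (FreeGroup.mk z ^ m).norm := fun m =>
    calc m ≤ m * z.count x := Nat.le_mul_of_pos_right m hpos
      _ = letterCount x (FreeGroup.mk z ^ m) := (hz.letterCount_pow x m).symm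
      _ ≤ _ := letterCount_le_norm x _
  obtain ⟨m, rfl | rfl⟩ := n.eq_nat_or_neg
  · rw [zpow_natCast]
    exact hpow m
  · rw [zpow_neg, zpow_natCast, FreeGroup.norm_inv_eq, Int.natAbs_neg]
    exact hpow m

theorem mem_closure_letters_iff {Y : Set (A × Bool)} {g : FreeGroup A} :
    g ∈ Submonoid.closure ((fun x => FreeGroup.mk [x]) '' Y) ↔ ∀ x ∈ g.toWord, x ∈ Y := by
  constructor
  · intro hg
    induction hg using Submonoid.closure_induction with
    | mem g hg =>
      obtain ⟨y, hy, rfl⟩ := hg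
      simpa [FreeGroup.toWord_mk, FreeGroup.reduce_singleton] using hy
    | one => simp
    | mul g h _ _ ihg ihh =>
      intro x hx
      rcases List.mem_append.1 ((FreeGroup.toWord_mul_sublist g h).subset hx) with hx | hx
      exacts [ihg x hx, ihh x hx]
  · suffices h : ∀ w : GroupWord A, (∀ x ∈ w, x ∈ Y) →
        FreeGroup.mk w ∈ Submonoid.closure ((fun x => FreeGroup.mk [x]) '' Y) by
      intro hg
      simpa [FreeGroup.mk_toWord] using h _ hg
    intro w
    induction w with
    | nil => exact fun _ => Submonoid.one_mem _
    | cons x w ih =>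
      intro hw
      rw [← List.singleton_append, ← FreeGroup.mul_mk]
      exact Submonoid.mul_mem _ (Submonoid.subset_closure ⟨x, hw x List.mem_cons_self, rfl⟩)
        (ih fun y hy => hw y (List.mem_cons_of_mem _ hy))

theorem mk_mem_closure_letters {Y : Set (A × Bool)} {w : GroupWord A} (hw : ∀ x ∈ w, x ∈ Y) :
    FreeGroup.mk w ∈ Submonoid.closure ((fun x => FreeGroup.mk [x]) '' Y) := by
  refine mem_closure_letters_iff.2 fun x hx => hw x ?_
  rw [FreeGroup.toWord_mk] at hx
  exact FreeGroup.reduce.red.sublist.subset hx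

end LetterCount

/-! ### Bounds for the exponents of shifts. -/

namespace StableData

variable {A E : Type} [DecidableEq A] [DecidableEq E] {S : StableData A E}
  {N : Submonoid (FreeGroup A)} {P : E → Bool} {x : A × Bool}

/-- Propagation from left to right. As `h * codᵐ` is free of `x`, each `x` in `codᵐ` already occurs
in `h⁻¹`. The next entry inherits at most that many from `domᵐ`, in addition to its own length, so
the total budget `B` is never exceeded. -/
theorem Shiftable.letterCount_cod_le (hN : ∀ y ∈ N, letterCount x y = 0)
    (hle : ∀ e, P e = true → ∀ n : ℤ, letterCount x (FreeGroup.mk (S.dom e) ^ n) ≤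
      letterCount x (FreeGroup.mk (S.cod e) ^ n)) {R : E → ℤ → Prop} {B : ℕ} :
    ∀ {l : List (E × FreeGroup A)} {h : FreeGroup A}, letterCount x h⁻¹ + totalNorm l ≤ B →
      S.Shiftable N P R h l →
      S.Shiftable N P (fun e m => R e m ∧ letterCount x (FreeGroup.mk (S.cod e) ^ m) ≤ B) h l
  | [], _, _, hs => hs
  | p :: l, h, hB, ⟨hP, m, hR, hm, hs⟩ => by
    have h1 : letterCount x (FreeGroup.mk (S.cod p.1) ^ m) ≤ letterCount x h⁻¹ := by
      have := letterCount_mul_le x h⁻¹ (h * FreeGroup.mk (S.cod p.1) ^ m)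
      rw [inv_mul_cancel_left, hN _ hm] at this
      exact this
    have h2 : letterCount x (FreeGroup.mk (S.dom p.1) ^ (-m) * p.2)⁻¹ ≤
        p.2.norm + letterCount x (FreeGroup.mk (S.dom p.1) ^ m) := by
      have h3 := letterCount_mul_le x p.2⁻¹ (FreeGroup.mk (S.dom p.1) ^ m)
      have h4 := letterCount_le_norm x p.2⁻¹
      rw [FreeGroup.norm_inv_eq] at h4
      rw [mul_inv_rev, zpow_neg, inv_inv]
      omega
    have h5 := hle p.1 hP m
    simp only [totalNorm, List.map_cons, List.sum_cons] at hB
    refine ⟨hP, m, ⟨hR, by omega⟩, hm, hs.letterCount_cod_le hN hle ?_⟩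
    simp only [totalNorm]
    omega

/-- The mirror image, propagated from the last entry to the first: the last shifted entry is free of
`x`, and this limits the occurrences of `x` in `dom⁻ᵐ`, hence in `cod⁻ᵐ`, hence in the entry before.
-/
theorem Shiftable.letterCount_dom_le (hN : ∀ y ∈ N, letterCount x y = 0)
    (hle : ∀ e, P e = true → ∀ n : ℤ, letterCount x (FreeGroup.mk (S.cod e) ^ n) ≤
      letterCount x (FreeGroup.mk (S.dom e) ^ n)) {R : E → ℤ → Prop} {B : ℕ} :
    ∀ {l : List (E × FreeGroup A)} {h : FreeGroup A}, totalNorm l ≤ B →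
      S.Shiftable N P R h l → letterCount x h ≤ totalNorm l ∧
      S.Shiftable N P (fun e m => R e m ∧ letterCount x (FreeGroup.mk (S.dom e) ^ (-m)) ≤ B) h l
  | [], h, _, hs => ⟨(hN h hs).le.trans (Nat.zero_le _), hs⟩
  | p :: l, h, hB, ⟨hP, m, hR, hm, hs⟩ => by
    simp only [totalNorm, List.map_cons, List.sum_cons] at hB ⊢
    have ih := hs.letterCount_dom_le hN hle (B := B) (by simp only [totalNorm]; omega)
    have h1 : letterCount x h ≤ letterCount x (FreeGroup.mk (S.cod p.1) ^ (-m)) := by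
      have := letterCount_mul_le x (h * FreeGroup.mk (S.cod p.1) ^ m)
        (FreeGroup.mk (S.cod p.1) ^ (-m))
      rw [hN _ hm, zpow_neg, mul_inv_cancel_right, zero_add] at this
      rwa [zpow_neg]
    have h2 : letterCount x (FreeGroup.mk (S.dom p.1) ^ (-m)) ≤
        letterCount x (FreeGroup.mk (S.dom p.1) ^ (-m) * p.2) + p.2.norm := by
      have h3 := letterCount_mul_le x (FreeGroup.mk (S.dom p.1) ^ (-m) * p.2) p.2⁻¹
      have h4 := letterCount_le_norm x p.2⁻¹
      rw [FreeGroup.norm_inv_eq] at h4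
      rw [mul_inv_cancel_right] at h3
      omega
    have h5 := hle p.1 hP (-m)
    have h6 := ih.1
    simp only [totalNorm] at h6
    exact ⟨by omega, hP, m, ⟨hR, by omega⟩, hm, ih.2⟩

/-- When `N` avoids a letter `x` that the powers of `dom` and `cod` contain often, exponents of
shifts are bounded. -/
theorem Shiftable.bounded (hN : ∀ y ∈ N, letterCount x y = 0)
    (hcount : (∀ e, P e = true → ∀ n : ℤ,
        letterCount x (FreeGroup.mk (S.dom e) ^ n) ≤ letterCount x (FreeGroup.mk (S.cod e) ^ n) ∧
        n.natAbs ≤ letterCount x (FreeGroup.mk (S.cod e) ^ n)) ∨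
      (∀ e, P e = true → ∀ n : ℤ,
        letterCount x (FreeGroup.mk (S.cod e) ^ n) ≤ letterCount x (FreeGroup.mk (S.dom e) ^ n) ∧
        n.natAbs ≤ letterCount x (FreeGroup.mk (S.dom e) ^ n)) ∨
      (∀ e, P e = true → ∀ n : ℤ,
        letterCount x (FreeGroup.mk (S.dom e) ^ n) = letterCount x (FreeGroup.mk (S.cod e) ^ n) ∧
        n.natAbs ≤ max (letterCount x (FreeGroup.mk (S.cod e) ^ n))
          (letterCount x (FreeGroup.mk (S.cod e) ^ (-n)))))
    {h : FreeGroup A} {l : List (E × FreeGroup A)} {B : ℕ} (hB : h.norm + totalNorm l ≤ B)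
    (hs : S.Shiftable N P (fun _ _ => True) h l) :
    S.Shiftable N P (fun _ m => m.natAbs ≤ B) h l := by
  have hB1 : letterCount x h⁻¹ + totalNorm l ≤ B := by
    have := letterCount_le_norm x h⁻¹
    rw [FreeGroup.norm_inv_eq] at this
    omega
  have hB2 : totalNorm l ≤ B := by omega
  rcases hcount with hc | hc | hc
  · refine (hs.letterCount_cod_le hN (fun e he n => (hc e he n).1) hB1).mono ?_
    exact fun e m he hm => (hc e he m).2.trans hm.2
  · refine (hs.letterCount_dom_le hN (fun e he n => (hc e he n).1) hB2).2.mono ?_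
    intro e m he hm
    have := (hc e he (-m)).2.trans hm.2
    rwa [Int.natAbs_neg] at this
  · refine ((hs.letterCount_cod_le hN (fun e he n => (hc e he n).1.le) hB1).letterCount_dom_le hN
      (fun e he n => (hc e he n).1.ge) hB2).2.mono ?_
    intro e m he hm
    refine (hc e he m).2.trans (max_le hm.1.2 ?_)
    rw [← (hc e he (-m)).1]
    exact hm.2

/-- When `N` contains the powers of `dom` and `cod`, no shift is needed. -/
theorem Shiftable.zero (hdom : ∀ e, P e = true → ∀ n : ℤ, FreeGroup.mk (S.dom e) ^ n ∈ N)
    (hcod : ∀ e, P e = true → ∀ n : ℤ, FreeGroup.mk (S.cod e) ^ n ∈ N) (B : ℕ) :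
    ∀ {l : List (E × FreeGroup A)} {h g : FreeGroup A}, g ∈ N →
      S.Shiftable N P (fun _ _ => True) h l →
      S.Shiftable N P (fun _ m => m.natAbs ≤ B) (g * h) l
  | [], h, g, hg, hs => N.mul_mem hg hs
  | p :: l, h, g, hg, ⟨hP, m, _, hm, hs⟩ => by
    refine ⟨hP, 0, by simp, ?_, ?_⟩
    · have := N.mul_mem hg (N.mul_mem hm (hcod p.1 hP (-m)))
      rwa [zpow_neg, mul_inv_cancel_right, ← mul_one h, ← mul_assoc] at this
    · have := hs.zero hdom hcod B (hdom p.1 hP m)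
      rwa [zpow_neg, mul_inv_cancel_left, ← one_mul p.2] at this

end StableData

/-! ### Finite enumeration of concatenations of blocks. -/

section Concatenations

variable {A : Type}

/-- The words that are concatenations of at most `n` blocks. -/
def concatenations (G : List (GroupWord A)) (n : ℕ) : List (GroupWord A) :=
  Nat.rec [[]] (fun _ C => [] :: G.flatMap fun b => C.map fun w => b ++ w) n

theorem mem_concatenations_iff {G : List (GroupWord A)} {n : ℕ} {w : GroupWord A} :
    w ∈ concatenations G n ↔
      ∃ bs : List (GroupWord A), bs.length ≤ n ∧ (∀ b ∈ bs, b ∈ G) ∧ bs.flatten = w := by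
  induction n generalizing w with
  | zero =>
    refine ⟨fun h => ⟨[], by simp_all [concatenations]⟩, ?_⟩
    rintro ⟨bs, hl, -, rfl⟩
    rw [List.eq_nil_of_length_eq_zero (Nat.le_zero.1 hl)]
    exact List.mem_singleton_self _
  | succ n ih =>
    have : concatenations G (n + 1) =
      [] :: G.flatMap fun b => (concatenations G n).map fun w => b ++ w := rfl
    simp only [this, List.mem_cons, List.mem_flatMap, List.mem_map, ih]
    constructor
    · rintro (rfl | ⟨b, hb, _, ⟨bs, hl, hG, rfl⟩, rfl⟩)
      · exact ⟨[], by simp⟩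
      · exact ⟨b :: bs, by simpa using hl, by simpa using ⟨hb, hG⟩, rfl⟩
    · rintro ⟨_ | ⟨b, bs⟩, hl, hG, rfl⟩
      · exact Or.inl rfl
      · exact Or.inr ⟨b, hG b List.mem_cons_self, _, ⟨bs, by simpa using hl,
          fun c hc => hG c (List.mem_cons_of_mem _ hc), rfl⟩, rfl⟩

theorem Primrec.concatenations [Primcodable A] (G : List (GroupWord A)) :
    Primrec (concatenations G) := by
  refine Primrec.nat_rec₁ [[]] ?_
  refine Primrec.list_cons.comp (Primrec.const []) (Primrec.list_flatMap (Primrec.const G)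
    (Primrec.list_map (Primrec.snd.comp Primrec.fst) ?_))
  exact Primrec.list_append.comp (Primrec.snd.comp Primrec.fst) Primrec.snd

theorem length_le_length_flatten {bs : List (GroupWord A)} (h : ∀ b ∈ bs, b ≠ []) :
    bs.length ≤ bs.flatten.length := by
  induction bs with
  | nil => simp
  | cons b bs ih =>
    have h1 := List.length_pos_iff.2 (h b List.mem_cons_self)
    have h2 := ih fun c hc => h c (List.mem_cons_of_mem _ hc)
    simp only [List.length_cons, List.flatten_cons, List.length_append]
    omega

end Concatenations

/-! ### Membership in the submonoid generated by letters and one word of constant sign. -/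

section PositiveWord

variable {A : Type} [DecidableEq A] (Y : Set (A × Bool)) (z : GroupWord A)

/-- What may be left of `z` after cancellation of a prefix and of a suffix against letters
of `Y`. -/
def IsRemnant (m : GroupWord A) : Prop :=
  ∃ e f, z = e ++ m ++ f ∧ (∀ x ∈ e, (x.1, !x.2) ∈ Y) ∧ ∀ x ∈ f, (x.1, !x.2) ∈ Y

/-- Letters of `Y` and remnants of `z`. -/
def IsBlock (b : GroupWord A) : Prop := (∃ y ∈ Y, b = [y]) ∨ IsRemnant Y z b

/-- Concatenations of blocks. -/
def IsBlockWord (w : GroupWord A) : Prop :=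
  ∃ bs : List (GroupWord A), (∀ b ∈ bs, IsBlock Y z b) ∧ bs.flatten = w

/-- The submonoid generated by the letters of `Y` and by `z`. -/
def adjoinWord : Submonoid (FreeGroup A) :=
  Submonoid.closure ((fun x => FreeGroup.mk [x]) '' Y ∪ {FreeGroup.mk z})

variable {Y z}

theorem mk_mem_adjoinWord {w : GroupWord A} (hw : ∀ x ∈ w, x ∈ Y) :
    FreeGroup.mk w ∈ adjoinWord Y z :=
  Submonoid.closure_mono Set.subset_union_left (mk_mem_closure_letters hw)

theorem self_mem_adjoinWord : FreeGroup.mk z ∈ adjoinWord Y z :=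
  Submonoid.subset_closure (Or.inr rfl)

theorem mk_invRev_mem_adjoinWord {w : GroupWord A} (hw : ∀ x ∈ w, (x.1, !x.2) ∈ Y) :
    (FreeGroup.mk w)⁻¹ ∈ adjoinWord Y z := by
  rw [FreeGroup.inv_mk]
  refine mk_mem_adjoinWord fun x hx => ?_
  simp only [FreeGroup.invRev, List.mem_reverse, List.mem_map] at hx
  obtain ⟨y, hy, rfl⟩ := hx
  exact hw y hy

theorem IsBlockWord.mk_mem {w : GroupWord A} (hw : IsBlockWord Y z w) :
    FreeGroup.mk w ∈ adjoinWord Y z := by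
  obtain ⟨bs, hbs, rfl⟩ := hw
  induction bs with
  | nil => exact Submonoid.one_mem _
  | cons b bs ih =>
    rw [List.flatten_cons, ← FreeGroup.mul_mk]
    refine Submonoid.mul_mem _ ?_ (ih fun c hc => hbs c (List.mem_cons_of_mem _ hc))
    rcases hbs b List.mem_cons_self with ⟨y, hy, rfl⟩ | ⟨e, f, hz, he, hf⟩
    · exact mk_mem_adjoinWord (by simpa using hy)
    · have : FreeGroup.mk b = (FreeGroup.mk e)⁻¹ * FreeGroup.mk z * (FreeGroup.mk f)⁻¹ := by
        rw [hz, ← FreeGroup.mul_mk, ← FreeGroup.mul_mk]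
        group
      rw [this]
      exact Submonoid.mul_mem _ (Submonoid.mul_mem _ (mk_invRev_mem_adjoinWord he)
        self_mem_adjoinWord) (mk_invRev_mem_adjoinWord hf)

theorem IsBlockWord.append_block {b w : GroupWord A} (hb : IsBlock Y z b)
    (hw : IsBlockWord Y z w) : IsBlockWord Y z (b ++ w) := by
  obtain ⟨bs, hbs, rfl⟩ := hw
  exact ⟨b :: bs, by simpa using ⟨hb, hbs⟩, rfl⟩

section

variable {s : Bool} (hs : ∀ x ∈ z, x.2 = s) (hY : ∃ x ∈ z, (x.1, !s) ∉ Y)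

include hs

theorem IsRemnant.sign {m : GroupWord A} (hm : IsRemnant Y z m) : ∀ x ∈ m, x.2 = s := by
  obtain ⟨e, f, rfl, -⟩ := hm
  exact fun x hx => hs x (by simp [hx])

include hY

/-- Some letter of `z` has its inverse outside `Y`, so it can never be cancelled away. -/
theorem IsRemnant.ne_nil {m : GroupWord A} (hm : IsRemnant Y z m) : m ≠ [] := by
  rintro rfl
  obtain ⟨e, f, rfl, he, hf⟩ := hm
  obtain ⟨x, hx, hxY⟩ := hY
  have hsx := hs x hx
  rw [List.append_nil, List.mem_append] at hx
  rcases hx with hx | hx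
  · exact hxY (hsx ▸ he x hx)
  · exact hxY (hsx ▸ hf x hx)

theorem IsBlock.ne_nil {b : GroupWord A} (hb : IsBlock Y z b) : b ≠ [] := by
  rcases hb with ⟨y, -, rfl⟩ | hb
  · simp
  · exact hb.ne_nil hs hY

/-- The first letter of a block word can be removed if its inverse is in `Y`, or if it is itself the
inverse of a letter of `z`. -/
theorem IsBlockWord.tail {x : A × Bool} {w : GroupWord A} (hw : IsBlockWord Y z (x :: w)) :
    ((x.1, !x.2) ∈ Y → IsBlockWord Y z w) ∧ (x.2 = !s → x ∈ Y ∧ IsBlockWord Y z w) := by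
  obtain ⟨_ | ⟨b, bs⟩, hbs, heq⟩ := hw
  · simp at heq
  have hb := hbs b List.mem_cons_self
  have hbs' : IsBlockWord Y z bs.flatten :=
    ⟨bs, fun c hc => hbs c (List.mem_cons_of_mem _ hc), rfl⟩
  rcases hb with ⟨y, hy, rfl⟩ | hb
  · obtain ⟨rfl, rfl⟩ := List.cons.inj heq
    exact ⟨fun _ => hbs', fun _ => ⟨hy, hbs'⟩⟩
  · rcases b with _ | ⟨y, b⟩
    · exact absurd rfl (hb.ne_nil hs hY)
    obtain ⟨rfl, rfl⟩ := List.cons.inj heq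
    constructor
    · intro hy
      obtain ⟨e, f, hz, he, hf⟩ := hb
      refine hbs'.append_block (Or.inr ⟨e ++ [y], f, by simp [hz], ?_, hf⟩)
      intro x hx
      rcases List.mem_append.1 hx with hx | hx
      · exact he x hx
      · rw [List.mem_singleton.1 hx]
        exact hy
    · intro h
      have := hb.sign hs y List.mem_cons_self
      rw [h] at this
      simp at this

theorem IsBlockWord.letter_mul {y : A × Bool} (hy : y ∈ Y) {g : FreeGroup A}
    (hg : IsBlockWord Y z g.toWord) : IsBlockWord Y z (FreeGroup.mk [y] * g).toWord := by
  have h : (FreeGroup.mk [y] * g).toWord = FreeGroup.reduce (y :: g.toWord) := by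
    conv_lhs => rw [← FreeGroup.mk_toWord (x := g), FreeGroup.mul_mk, FreeGroup.toWord_mk]
    rfl
  rw [h, FreeGroup.reduce.cons, FreeGroup.reduce_toWord]
  rcases hw : g.toWord with _ | ⟨x, w⟩
  · exact ⟨[[y]], fun b hb => Or.inl ⟨y, hy, List.mem_singleton.1 hb⟩, rfl⟩
  · rw [hw] at hg
    simp only
    split_ifs with hc
    · refine (hg.tail hs hY).1 ?_
      rwa [← hc.1, ← hc.2]
    · exact hg.append_block (b := [y]) (Or.inl ⟨y, hy, rfl⟩)

/-- If the last letter of `m` cancels, the first letter of `g` has the sign opposite to that of `z`.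
It therefore belongs to no remnant and is a letter of `Y`, so `m` without its last letter is again a
remnant. If nothing cancels, `m` is simply a new block, since a word of constant sign is reduced. -/
theorem IsBlockWord.remnant_mul : ∀ {n : ℕ} {m : GroupWord A}, m.length = n → IsRemnant Y z m →
    ∀ {g : FreeGroup A}, IsBlockWord Y z g.toWord →
      IsBlockWord Y z (FreeGroup.mk m * g).toWord := by
  intro n
  induction n with
  | zero =>
    intro m hn hm
    exact absurd (List.eq_nil_of_length_eq_zero hn) (hm.ne_nil hs hY)
  | succ n ih =>
    intro m hn hm g hg
    by_cases hc : ∃ m' x w, m = m' ++ [x] ∧ g.toWord = (x.1, !x.2) :: w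
    · obtain ⟨m', x, w, rfl, hw⟩ := hc
      have hx : x.2 = s := hm.sign hs x (by simp)
      rw [hw] at hg
      obtain ⟨hxY, hw'⟩ := (hg.tail hs hY).2 (by simp [hx])
      have hred : FreeGroup.IsReduced w :=
        (hw ▸ FreeGroup.isReduced_toWord (x := g) : FreeGroup.IsReduced (_ :: w)).tail
      have heq : FreeGroup.mk (m' ++ [x]) * g = FreeGroup.mk m' * FreeGroup.mk w := by
        have : g = (FreeGroup.mk [x])⁻¹ * FreeGroup.mk w := by
          rw [← FreeGroup.mk_toWord (x := g), hw, FreeGroup.inv_mk, FreeGroup.mul_mk]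
          rfl
        rw [this, ← FreeGroup.mul_mk]
        group
      rw [heq]
      refine ih (by simpa using hn) ?_ ?_
      · obtain ⟨e, f, hz, he, hf⟩ := hm
        refine ⟨e, x :: f, by simp [hz], he, ?_⟩
        exact List.forall_mem_cons.2 ⟨hxY, hf⟩
      · rwa [FreeGroup.toWord_mk, hred.reduce_eq]
    · have hred : FreeGroup.IsReduced (m ++ g.toWord) := by
        refine List.isChain_append.2 ⟨?_, FreeGroup.isReduced_toWord, ?_⟩
        · refine List.Pairwise.isChain (List.pairwise_of_forall_mem_list ?_)
          intro a ha b hb _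
          rw [hm.sign hs a ha, hm.sign hs b hb]
        · intro x hx y hy hxy
          by_contra hne
          have hy' : y = (x.1, !x.2) := by
            refine Prod.ext hxy.symm ?_
            cases h1 : x.2 <;> cases h2 : y.2 <;> simp_all
          exact hc ⟨m.dropLast, x, g.toWord.tail, (List.dropLast_append_getLast? x hx).symm,
            hy' ▸ (List.cons_head?_tail hy).symm⟩
      have : (FreeGroup.mk m * g).toWord = m ++ g.toWord := by
        conv_lhs => rw [← FreeGroup.mk_toWord (x := g), FreeGroup.mul_mk, FreeGroup.toWord_mk]
        exact hred.reduce_eq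
      rw [this]
      exact hg.append_block (Or.inr hm)

/-- Block words evaluate into the submonoid, and reduced block words are stable under left
multiplication by the generators. Cancellation therefore never has to be guessed. -/
theorem isBlockWord_toWord_iff {g : FreeGroup A} :
    IsBlockWord Y z g.toWord ↔ g ∈ adjoinWord Y z := by
  refine ⟨fun h => by simpa [FreeGroup.mk_toWord] using h.mk_mem, fun h => ?_⟩
  induction h using Submonoid.closure_induction_left with
  | one => exact ⟨[], by simp, by simp⟩
  | mul_left x hx g _ ih =>
    rcases hx with ⟨y, hy, rfl⟩ | rfl
    · exact ih.letter_mul hs hY hy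
    · exact IsBlockWord.remnant_mul hs hY rfl ⟨[], [], by simp, by simp, by simp⟩ ih

/-- Membership in `adjoinWord Y z` can be read off the reduced word. -/
theorem exists_primrec_mem_adjoinWord [Finite A] [Primcodable A] :
    ∃ L : GroupWord A → Bool, Primrec L ∧
      ∀ w, L (FreeGroup.reduce w) = true ↔ FreeGroup.mk w ∈ adjoinWord Y z := by
  have hfin : {b | IsBlock Y z b}.Finite := by
    refine Set.Finite.subset (((Set.toFinite Y).image fun y => [y]).union
      (List.finite_toSet z.sublists)) ?_
    rintro b (⟨y, hy, rfl⟩ | ⟨e, f, hz, -⟩)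
    · exact Or.inl ⟨y, hy, rfl⟩
    · refine Or.inr (List.mem_sublists.2 ?_)
      rw [hz]
      exact (List.sublist_append_right e b).trans (List.sublist_append_left _ f)
  have hmem : PrimrecPred fun w : GroupWord A =>
      ∃ v ∈ concatenations hfin.toFinset.toList w.length, v = w :=
    PrimrecRel.comp (PrimrecRel.exists_mem_list (R := fun v w : GroupWord A => v = w) Primrec.eq)
      ((Primrec.concatenations _).comp Primrec.list_length) Primrec.id
  classical
  refine ⟨fun w => decide (∃ v ∈ concatenations hfin.toFinset.toList w.length, v = w),
    hmem.decide, fun w => ?_⟩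
  rw [decide_eq_true_iff, ← isBlockWord_toWord_iff hs hY, FreeGroup.toWord_mk]
  simp only [exists_eq_right, mem_concatenations_iff, Finset.mem_toList, Set.Finite.mem_toFinset,
    Set.mem_ofPred_eq]
  constructor
  · rintro ⟨bs, -, hbs, heq⟩
    exact ⟨bs, hbs, heq⟩
  · rintro ⟨bs, hbs, heq⟩
    exact ⟨bs, heq ▸ length_le_length_flatten fun b hb => (hbs b hb).ne_nil hs hY, hbs, heq⟩

end

end PositiveWord

/-! ### Transfer of decidability from a larger group. -/

section Transfer

namespace OneRelatorGroup

variable {A : Type} {r : GroupWord A} {H : Type} [Group H]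

theorem ofWord_eq_prod (u : GroupWord A) :
    ofWord r u = (u.map fun x => ofWord r [x]).prod := by
  induction u with
  | nil => exact map_one _
  | cons x u ih =>
    rw [List.map_cons, List.prod_cons, ← ih, ← List.singleton_append]
    simp only [ofWord, ← FreeGroup.mul_mk, map_mul]

theorem toGroup_ofWord {f : A → H} (hf : ∀ r' ∈ ({FreeGroup.mk r} : Set (FreeGroup A)),
    FreeGroup.lift f r' = 1) (u : GroupWord A) :
    PresentedGroup.toGroup hf (ofWord r u) = FreeGroup.lift f (FreeGroup.mk u) := rfl

theorem lift_of_mk (u : GroupWord A) :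
    FreeGroup.lift (fun x => (PresentedGroup.of x : OneRelatorGroup r)) (FreeGroup.mk u) =
      ofWord r u := by
  have : FreeGroup.lift (fun x => (PresentedGroup.of x : OneRelatorGroup r)) =
      PresentedGroup.mk {FreeGroup.mk r} := by
    ext x
    simp [PresentedGroup.of]
  rw [this]
  rfl

theorem ofWord_self : ofWord r r = 1 := PresentedGroup.one_of_mem (Set.mem_singleton _)

/-- Membership can be decided in any group that contains `⟨A | r = 1⟩`. -/
theorem decidableMembership_of_hom [Primcodable A] {f : A → H}
    (hf : FreeGroup.lift f (FreeGroup.mk r) = 1)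
    (ρ : H →* OneRelatorGroup r) (hρ : ∀ x, ρ (f x) = PresentedGroup.of x) {v : A × Bool → H}
    (hv : ∀ x, v x = FreeGroup.lift f (FreeGroup.mk [x])) {X : Set (A × Bool)}
    (hX : PrimrecPred fun u : GroupWord A => (u.map v).prod ∈ Submonoid.closure (v '' X)) :
    DecidableMembership r (Submonoid.closure ((fun x => ofWord r [x]) '' X)) := by
  have hf' : ∀ r' ∈ ({FreeGroup.mk r} : Set (FreeGroup A)), FreeGroup.lift f r' = 1 := by
    rintro _ rfl
    exact hf
  let θ : OneRelatorGroup r →* H := PresentedGroup.toGroup hf'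
  have hθ : Function.Injective θ := by
    -- The one-relator group is a retract of `H`, so `H` may contain superfluous generators.
    refine Function.LeftInverse.injective (g := ρ) fun g => ?_
    have : ρ.comp θ = MonoidHom.id _ := PresentedGroup.ext fun x => by simp [θ, hρ]
    exact DFunLike.congr_fun this g
  have hθv : ∀ x, θ (ofWord r [x]) = v x := fun x => by rw [hv, toGroup_ofWord]
  refine (hX.of_eq fun u => ?_).computablePred
  have hprod : (u.map v).prod = θ (ofWord r u) := by
    rw [ofWord_eq_prod, map_list_prod, List.map_map]
    congr 2
    exact funext fun x => (hθv x).symm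
  have hmap : Submonoid.closure (v '' X) =
      (Submonoid.closure ((fun x => ofWord r [x]) '' X)).map θ := by
    rw [MonoidHom.map_mclosure, Set.image_image]
    congr 1
    exact Set.image_congr fun x _ => (hθv x).symm
  rw [hprod, hmap, Submonoid.mem_map_iff_mem hθ]

end OneRelatorGroup

end Transfer

theorem lift_mk_congr {A K : Type} [Group K] {f : A → K} {ψ : FreeGroup A →* K} {w : GroupWord A}
    (h : ∀ x ∈ w, f x.1 = ψ (FreeGroup.of x.1)) :
    FreeGroup.lift f (FreeGroup.mk w) = ψ (FreeGroup.mk w) := by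
  induction w with
  | nil => exact (map_one (FreeGroup.lift f)).trans (map_one ψ).symm
  | cons x w ih =>
    have hx := h x List.mem_cons_self
    obtain ⟨x, b⟩ := x
    rw [← List.singleton_append, ← FreeGroup.mul_mk, map_mul, map_mul,
      ih fun y hy => h y (List.mem_cons_of_mem _ hy)]
    congr 1
    cases b
    · have : FreeGroup.mk [(x, false)] = (FreeGroup.of x)⁻¹ := rfl
      rw [this, map_inv, map_inv, FreeGroup.lift_apply_of, hx]
    · exact FreeGroup.lift_apply_of.trans hx

/-! ### Words all of whose powers are reduced. -/

section PowersReduced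

variable {A : Type} [DecidableEq A]

theorem FreeGroup.IsReduced.append {u v : GroupWord A} (hu : FreeGroup.IsReduced u)
    (hv : FreeGroup.IsReduced v) (h : ∀ x ∈ u, ∀ y ∈ v, x.1 = y.1 → x.2 = y.2) :
    FreeGroup.IsReduced (u ++ v) :=
  List.isChain_append.2 ⟨hu, hv, fun x hx y hy =>
    h x (List.mem_of_mem_getLast? hx) y (List.mem_of_mem_head? hy)⟩

theorem FreeGroup.IsReduced.invRev {u : GroupWord A} (hu : FreeGroup.IsReduced u) :
    FreeGroup.IsReduced (FreeGroup.invRev u) :=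
  FreeGroup.IsReduced.of_reduce_eq (by rw [FreeGroup.reduce_invRev, hu.reduce_eq])

theorem powersReduced_of_append_self {z : GroupWord A} (hz : FreeGroup.IsReduced (z ++ z)) :
    PowersReduced z := by
  rcases eq_or_ne z [] with rfl | hne
  · intro n
    rw [List.eq_nil_of_length_eq_zero (by simp [length_wordPow] : (wordPow n []).length = 0)]
    exact FreeGroup.IsReduced.nil
  have h : ∀ n, FreeGroup.IsReduced (wordPow n z ++ z) := by
    intro n
    induction n with
    | zero => exact hz.infix ⟨[], z, by simp [wordPow]⟩
    | succ n ih =>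
      rw [wordPow_succ]
      exact FreeGroup.IsReduced.append_overlap ih hz hne
  exact fun n => (h n).infix ⟨[], z, rfl⟩

theorem powersReduced_of_sign {z : GroupWord A} {s : Bool} (hz : ∀ x ∈ z, x.2 = s) :
    PowersReduced z := by
  refine powersReduced_of_append_self (List.Pairwise.isChain ?_)
  refine List.pairwise_of_forall_mem_list ?_
  intro a ha b hb _
  have h : ∀ x ∈ z ++ z, x.2 = s := by simpa using hz
  rw [h a ha, h b hb]

/-- The final `s` separates consecutive copies of `w` and cannot cancel, as `w` does not involve the
generator `s`. -/
theorem powersReduced_concat {w : GroupWord A} (hw : FreeGroup.IsReduced w) {s : A}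
    (hs : ∀ x ∈ w, x.1 ≠ s) : PowersReduced (w ++ [(s, true)]) := by
  have h1 : FreeGroup.IsReduced (w ++ [(s, true)]) :=
    hw.append FreeGroup.IsReduced.singleton fun x hx y hy h => by
      rw [List.mem_singleton.1 hy] at h
      exact absurd h (hs x hx)
  have h2 : FreeGroup.IsReduced ([(s, true)] ++ (w ++ [(s, true)])) := by
    refine FreeGroup.IsReduced.singleton.append h1 fun x hx y hy h => ?_
    rw [List.mem_singleton.1 hx] at h ⊢
    rcases List.mem_append.1 hy with hy | hy
    · exact absurd h.symm (hs y hy)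
    · rw [List.mem_singleton.1 hy]
  refine powersReduced_of_append_self ?_
  have := FreeGroup.IsReduced.append_overlap h1 h2 (by simp)
  simpa using this

end PowersReduced

/-- Infinite cyclic subgroups are isomorphic. -/
theorem exists_zpowers_mulEquiv {G : Type} [Group G] {x y : G}
    (hx : ∀ n : ℤ, x ^ n = 1 → n = 0) (hy : ∀ n : ℤ, y ^ n = 1 → n = 0) :
    ∃ φ : Subgroup.zpowers x ≃* Subgroup.zpowers y, ∀ (n : ℤ) (a : Subgroup.zpowers x),
      (a : G) = x ^ n → (φ a : G) = y ^ n := by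
  have key : ∀ z : G, (∀ n : ℤ, z ^ n = 1 → n = 0) →
      ∃ ψ : Multiplicative ℤ ≃* Subgroup.zpowers z, ∀ n : ℤ, (ψ (.ofAdd n) : G) = z ^ n := by
    intro z hz
    have hinj : Function.Injective (zpowersHom G z) := by
      refine (injective_iff_map_eq_one _).2 fun n hn => ?_
      exact hz n.toAdd (by simpa [zpowersHom_apply] using hn)
    refine ⟨(MonoidHom.ofInjective hinj).trans
      (MulEquiv.subgroupCongr (Subgroup.range_zpowersHom z)), fun n => ?_⟩
    rfl
  obtain ⟨ψ, hψ⟩ := key x hx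
  obtain ⟨χ, hχ⟩ := key y hy
  refine ⟨ψ.symm.trans χ, fun n a h => ?_⟩
  have : a = ψ (.ofAdd n) := Subtype.ext (h.trans (hψ n).symm)
  rw [this, MulEquiv.trans_apply, MulEquiv.symm_apply_apply, hχ]

/-! ### Relators that define an HNN extension. -/

section HNN

variable {A : Type} [DecidableEq A]

/-- The data of the group in which `t` conjugates `s` to `p * s`. -/
def hnnData (t s : A) (p : GroupWord A) : StableData A Bool where
  letter x := if x.1 = t then some ([], x.2) else none
  dom e := bif e then [(s, true)] else p ++ [(s, true)]
  cod e := bif e then p ++ [(s, true)] else [(s, true)]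
  opp e := !e
  fold _ := []

/-- A stable letter or its inverse. -/
def hnnSign (e : Bool) : ℤˣ := bif e then 1 else -1

/-- The last field of `Realizes` is Britton's lemma for `HNNExtension`. The exponent bound holds
because both associated subgroups are generated by nonempty words with reduced powers. -/
theorem realizes_hnnData {t s : A} {p : GroupWord A} (hp : PowersReduced (p ++ [(s, true)]))
    (φ : Subgroup.zpowers (FreeGroup.mk [(s, true)]) ≃*
      Subgroup.zpowers (FreeGroup.mk (p ++ [(s, true)])))
    (hφ : ∀ (n : ℤ) (a : Subgroup.zpowers (FreeGroup.mk [(s, true)])),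
      (a : FreeGroup A) = FreeGroup.mk [(s, true)] ^ n →
        (φ a : FreeGroup A) = FreeGroup.mk (p ++ [(s, true)]) ^ n) :
    (hnnData t s p).Realizes (HNNExtension.of (φ := φ))
      (fun e => HNNExtension.t ^ (hnnSign e : ℤ)) := by
  have hs : PowersReduced [(s, true)] := powersReduced_of_sign (s := true) (by simp)
  have hred : ∀ l : List (Bool × FreeGroup A), (hnnData t s p).Reduced l →
      (l.map fun q => (hnnSign q.1, q.2)).IsChain (fun a b => a.2 ∈ HNNExtension.toSubgroup
        (Subgroup.zpowers (FreeGroup.mk [(s, true)]))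
        (Subgroup.zpowers (FreeGroup.mk (p ++ [(s, true)]))) a.1 → a.1 = b.1) := by
    intro l hl
    refine (List.isChain_map _).2 (hl.imp ?_)
    rintro ⟨e, g⟩ ⟨e', g'⟩ h hg
    cases e <;> cases e' <;> simp_all [hnnData, hnnSign]
  have h1 : (HNNExtension.t * HNNExtension.of (FreeGroup.mk [(s, true)]) :
      HNNExtension _ _ _ φ) =
      HNNExtension.of (FreeGroup.mk (p ++ [(s, true)])) * HNNExtension.t := by
    have := HNNExtension.t_mul_of (φ := φ) ⟨FreeGroup.mk [(s, true)], Subgroup.mem_zpowers _⟩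
    rwa [hφ 1 _ (zpow_one _).symm, zpow_one] at this
  refine ⟨?_, ?_, ?_, ?_⟩
  · rintro (_ | _)
    · simp only [hnnData, hnnSign, cond_false, Units.val_neg, Units.val_one, zpow_neg, zpow_one]
      rw [inv_mul_eq_iff_eq_mul, ← mul_assoc, h1, mul_inv_cancel_right]
    · simpa [hnnData, hnnSign] using h1
  · rintro (_ | _) <;> simp [hnnData, hnnSign, ← FreeGroup.one_eq_mk]
  · rintro e g ⟨n, rfl⟩
    refine ⟨n, ?_, rfl⟩
    cases e
    · exact hp.natAbs_le_norm_zpow (by simp) n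
    · exact hs.natAbs_le_norm_zpow (by simp) n
  · intro g g' l l' hl hl' heq
    have h := HNNExtension.ReducedWord.map_fst_eq_and_of_prod_eq φ
      (w₁ := ⟨g, _, hred l hl⟩) (w₂ := ⟨g', _, hred l' hl'⟩) (by
        simp only [HNNExtension.NormalWord.ReducedWord.prod, List.map_map]
        exact heq)
    simp only [List.map_map] at h
    have hinj : Function.Injective hnnSign := by
      intro a b
      cases a <;> cases b <;> simp [hnnSign]
    have hfst : l.map Prod.fst = l'.map Prod.fst := by
      refine hinj.list_map ?_
      simpa only [List.map_map, Function.comp_def] using h.1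
    refine ⟨hfst, ?_, ?_⟩
    · rintro rfl
      obtain rfl : l' = [] := by simpa using hfst.symm
      exact HNNExtension.of_injective φ (by simpa [StableData.eval] using heq)
    · intro e he
      have := h.2 (hnnSign e) (by
        rcases l with _ | ⟨q, l⟩
        · simp at he
        · have : q.1 = e := by simpa using he
          simp [this])
      cases e
      · simpa [hnnSign, hnnData] using this
      · simpa [hnnSign, hnnData] using this

/-- Decidability for a relator that says that `t` conjugates `s` to `p * s`. -/
theorem decidableMembership_of_hnn [Finite A] [Primcodable A] {r : GroupWord A} {t s : A}
    (hts : t ≠ s) {p : GroupWord A} (hp : PowersReduced (p ++ [(s, true)]))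
    (hpt : ∀ x ∈ p, x.1 ≠ t) (hps : ∀ x ∈ p, x.1 ≠ s)
    (hnodup : p.Nodup) (hmem : ∀ x : A × Bool, x.1 ≠ t → x.1 ≠ s → x ∈ p)
    (hr : ∀ (K : Type) [Group K] (f : A → K), FreeGroup.lift f (FreeGroup.mk r) = 1 ↔
      f t * f s = FreeGroup.lift f (FreeGroup.mk p) * f s * f t)
    {X : Set (A × Bool)} {η : Bool} (hX : (t, !η) ∉ X) :
    OneRelatorGroup.DecidableMembership r
      (Submonoid.closure ((fun x => OneRelatorGroup.ofWord r [x]) '' X)) := by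
  classical
  have hs : PowersReduced [(s, true)] := powersReduced_of_sign (s := true) (by simp)
  have hinf : ∀ z : GroupWord A, PowersReduced z → z ≠ [] → ∀ n : ℤ,
      FreeGroup.mk z ^ n = 1 → n = 0 := by
    intro z hz hne n hn
    have := hz.natAbs_le_norm_zpow hne n
    rw [hn, FreeGroup.norm_one] at this
    omega
  obtain ⟨φ, hφ⟩ := exists_zpowers_mulEquiv (hinf _ hs (by simp)) (hinf _ hp (by simp))
  have hS := realizes_hnnData (t := t) hp φ hφ
  -- The base is free on all of `A`, so it keeps an idle generator `t` besides the stable letter;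
  -- the retraction `ρ` below sends both to the generator `t`.
  set f : A → HNNExtension (FreeGroup A) _ _ φ :=
    fun x => if x = t then HNNExtension.t else HNNExtension.of (FreeGroup.of x) with hf
  have hlift : ∀ w : GroupWord A, (∀ x ∈ w, x.1 ≠ t) →
      FreeGroup.lift f (FreeGroup.mk w) = HNNExtension.of (FreeGroup.mk w) :=
    fun w hw => lift_mk_congr fun x hx => if_neg (hw x hx)
  have hfr : FreeGroup.lift f (FreeGroup.mk r) = 1 := by
    rw [hr, hlift p hpt]
    have h1 := hS.conj true
    have hft : f t = HNNExtension.t := if_pos rfl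
    have hfs : f s = HNNExtension.of (FreeGroup.of s) := if_neg hts.symm
    rw [hft, hfs]
    simp only [hnnData, hnnSign, cond_true, Units.val_one, zpow_one] at h1
    exact h1.trans (congrArg (· * HNNExtension.t)
      (map_mul HNNExtension.of (FreeGroup.mk p) (FreeGroup.of s)))
  let ι : FreeGroup A →* OneRelatorGroup r := FreeGroup.lift PresentedGroup.of
  have hι : SemiconjBy (ι (FreeGroup.of t)) (ι (FreeGroup.mk [(s, true)]))
      (ι (FreeGroup.mk (p ++ [(s, true)]))) := by
    have := (hr _ (fun x => (PresentedGroup.of x : OneRelatorGroup r))).1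
      ((OneRelatorGroup.lift_of_mk r).trans OneRelatorGroup.ofWord_self)
    rw [← FreeGroup.mul_mk, map_mul]
    simpa [SemiconjBy, ι] using this
  let ρ : HNNExtension (FreeGroup A) _ _ φ →* OneRelatorGroup r :=
    HNNExtension.lift ι (ι (FreeGroup.of t)) (by
      intro a
      obtain ⟨n, hn⟩ := Subgroup.mem_zpowers_iff.1 a.2
      rw [hφ n a hn.symm, ← hn, map_zpow, map_zpow]
      exact (hι.zpow_right n).eq)
  have hρ : ∀ x, ρ (f x) = PresentedGroup.of x := by
    intro x
    by_cases hx : x = t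
    · simp [hf, hx, ρ, ι]
    · simp [hf, hx, ρ, ι]
  refine OneRelatorGroup.decidableMembership_of_hom hfr ρ hρ
    (v := (hnnData t s p).letterValue HNNExtension.of
      (fun e => HNNExtension.t ^ (hnnSign e : ℤ))) ?_ ?_
  · rintro ⟨x, b⟩
    by_cases hx : x = t
    · subst hx
      cases b
      · have : FreeGroup.mk [(x, false)] = (FreeGroup.of x)⁻¹ := rfl
        rw [this, map_inv, FreeGroup.lift_apply_of]
        simp [StableData.letterValue, hnnData, hnnSign, ← FreeGroup.one_eq_mk, hf]
      · have : FreeGroup.mk [(x, true)] = FreeGroup.of x := rfl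
        rw [this, FreeGroup.lift_apply_of]
        simp [StableData.letterValue, hnnData, hnnSign, ← FreeGroup.one_eq_mk, hf]
    · rw [hlift _ (by simpa using hx)]
      simp [StableData.letterValue, hnnData, hx]
  set Y : Set (A × Bool) := {x | x ∈ X ∧ x.1 ≠ t} with hYdef
  have hYp : PrimrecPred fun w : GroupWord A => ∀ x ∈ w, x ∈ Y :=
    PrimrecPred.forall_mem_list ⟨Classical.decPred _, Primrec.dom_finite _⟩
  refine hS.primrecPred_mem_closure (P := fun e => decide (e = η ∧ (t, η) ∈ X))
    (N := Submonoid.closure ((fun x => FreeGroup.mk [x]) '' Y))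
    (L := fun w => decide (∀ x ∈ w, x ∈ Y)) ?_ ?_ ?_ ?_ ?_ ?_ hYp.decide ?_
  · intro x hx hxl
    refine Submonoid.subset_closure ⟨x, ⟨hx, fun h => ?_⟩, rfl⟩
    simp [hnnData, h] at hxl
  · rintro ⟨x, b⟩ hx q e hxl
    by_cases hxt : x = t
    · subst hxt
      simp only [hnnData, if_true, Option.some.injEq, Prod.mk.injEq] at hxl
      obtain ⟨rfl, rfl⟩ := hxl
      have hb : b = η := by
        by_contra hb
        exact hX (by rwa [← Bool.eq_not_of_ne hb])
      subst hb
      simpa using hx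
    · simp [hnnData, hxt] at hxl
  · intro e he he'
    -- Only one sign of the stable letter is available, so products of generators contain no pinch.
    exact absurd ((of_decide_eq_true he').1.trans (of_decide_eq_true he).1.symm) (by simp [hnnData])
  · intro y hy
    have : Submonoid.closure ((fun x => FreeGroup.mk [x]) '' Y) ≤
        (Submonoid.closure ((hnnData t s p).letterValue HNNExtension.of
          (fun e => HNNExtension.t ^ (hnnSign e : ℤ)) '' X)).comap
            (HNNExtension.of (φ := φ)) := by
      rw [Submonoid.closure_le]
      rintro _ ⟨x, ⟨hx, hxt⟩, rfl⟩
      refine Submonoid.subset_closure ⟨x, hx, ?_⟩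
      simp [StableData.letterValue, hnnData, hxt]
    exact this hy
  · intro e he
    simp only [decide_eq_true_eq] at he
    refine Submonoid.subset_closure ⟨(t, e), he.1 ▸ he.2, ?_⟩
    simp [StableData.letterValue, hnnData, ← FreeGroup.one_eq_mk]
  · intro h l B hB hsh
    by_cases hall : ∀ x : A × Bool, x.1 ≠ t → x ∈ Y
    · have hmem : ∀ w : GroupWord A, (∀ x ∈ w, x.1 ≠ t) → ∀ n : ℤ,
          FreeGroup.mk w ^ n ∈ Submonoid.closure ((fun x => FreeGroup.mk [x]) '' Y) := by
        intro w hw n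
        obtain ⟨m, rfl | rfl⟩ := n.eq_nat_or_neg
        · rw [zpow_natCast]
          exact Submonoid.pow_mem _ (mk_mem_closure_letters fun x hx => hall x (hw x hx)) m
        · rw [zpow_neg, zpow_natCast, ← inv_pow, FreeGroup.inv_mk]
          refine Submonoid.pow_mem _ (mk_mem_closure_letters fun x hx => hall x ?_) m
          simp only [FreeGroup.invRev, List.mem_reverse, List.mem_map] at hx
          obtain ⟨y, hy, rfl⟩ := hx
          exact hw y hy
      have hs' : ∀ x ∈ [(s, true)], x.1 ≠ t := by simpa using hts.symm
      have hp' : ∀ x ∈ p ++ [(s, true)], x.1 ≠ t := by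
        intro x hx
        rcases List.mem_append.1 hx with hx | hx
        exacts [hpt x hx, hs' x hx]
      have := hsh.zero (fun e _ => hmem _ (by cases e <;> assumption))
        (fun e _ => hmem _ (by cases e <;> assumption)) B (Submonoid.one_mem _)
      rwa [one_mul] at this
    · push Not at hall
      obtain ⟨x, hxt, hxY⟩ := hall
      refine hsh.bounded (x := x) ?_ ?_ hB
      · intro y hy
        exact List.count_eq_zero.2 fun hx => hxY (mem_closure_letters_iff.1 hy x hx)
      · by_cases hxs : x.1 = s
        -- If `x` is `s` or `s⁻¹`, then `sⁿ` and `(p s)ⁿ` contain it equally often, but only for one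
        -- sign of `n` at all.
        · refine Or.inr (Or.inr fun e _ n => ?_)
          obtain ⟨x, b⟩ := x
          obtain rfl : x = s := hxs
          have h0 : ∀ b, p.count (x, b) = 0 := fun b =>
            List.count_eq_zero.2 fun hx => hps _ hx rfl
          cases e <;> cases b <;> simp only [hnnData, cond_true, cond_false,
            hs.letterCount_zpow, hp.letterCount_zpow] <;> simp [h0] <;> omega
        -- Otherwise `x` and `x⁻¹` occur once each in `p`, so `(p s)ⁿ` contains `x` exactly `|n|`
        -- times and `sⁿ` never. The sign `η` decides which of the two is `cod`, hence the direction
        -- of the propagation.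
        · have h1 := List.count_eq_one_of_mem hnodup (hmem x hxt hxs)
          have h2 := List.count_eq_one_of_mem hnodup (hmem (x.1, !x.2) hxt hxs)
          have h3 : [(s, true)].count x = 0 :=
            List.count_eq_zero.2 fun h => hxs (by rw [List.mem_singleton.1 h])
          have h4 : [(s, true)].count (x.1, !x.2) = 0 :=
            List.count_eq_zero.2 fun h => hxs (congrArg Prod.fst (List.mem_singleton.1 h))
          cases η
          · refine Or.inr (Or.inl fun e he n => ?_)
            simp only [decide_eq_true_eq] at he
            rw [he.1]
            simp only [hnnData, cond_false, hs.letterCount_zpow, hp.letterCount_zpow,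
              List.count_append, h1, h2, h3, h4]
            omega
          · refine Or.inl fun e he n => ?_
            simp only [decide_eq_true_eq] at he
            rw [he.1]
            simp only [hnnData, cond_true, hs.letterCount_zpow, hp.letterCount_zpow,
              List.count_append, h1, h2, h3, h4]
            omega
  · intro w
    rw [decide_eq_true_iff, mem_closure_letters_iff, FreeGroup.toWord_mk]

end HNN

/-! ### Orientable surface groups. -/

section Orientable

variable {g : ℕ}

/-- The product of the commutators `[aᵢ, bᵢ]`, `i ∈ l`. -/
def commutatorWord (l : List (Fin g)) : GroupWord (Fin g ⊕ Fin g) :=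
  l.flatMap fun i =>
    [(Sum.inl i, true), (Sum.inr i, true), (Sum.inl i, false), (Sum.inr i, false)]

theorem mem_commutatorWord {l : List (Fin g)} {x : (Fin g ⊕ Fin g) × Bool}
    (hx : x ∈ commutatorWord l) : ∃ i ∈ l, x.1 = Sum.inl i ∨ x.1 = Sum.inr i := by
  obtain ⟨i, hi, hx⟩ := List.mem_flatMap.1 hx
  refine ⟨i, hi, ?_⟩
  simp only [List.mem_cons, List.not_mem_nil, or_false] at hx
  rcases hx with rfl | rfl | rfl | rfl <;> simp

theorem mem_commutatorWord_of_mem {l : List (Fin g)} {i : Fin g} (hi : i ∈ l) (b : Bool) :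
    (Sum.inl i, b) ∈ commutatorWord l ∧ (Sum.inr i, b) ∈ commutatorWord l := by
  constructor <;> refine List.mem_flatMap.2 ⟨i, hi, ?_⟩ <;> cases b <;> simp

theorem nodup_commutatorWord {l : List (Fin g)} (hl : l.Nodup) : (commutatorWord l).Nodup := by
  refine List.nodup_flatMap.2 ⟨by simp, hl.imp fun hij x hx hy => ?_⟩
  simp only [List.mem_cons, List.not_mem_nil, or_false] at hx hy
  rcases hx with rfl | rfl | rfl | rfl <;> simp_all

theorem isReduced_commutatorWord {l : List (Fin g)} (hl : l.Nodup) :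
    FreeGroup.IsReduced (commutatorWord l) := by
  rw [commutatorWord, List.flatMap, FreeGroup.IsReduced, List.isChain_flatten (by simp)]
  refine ⟨by simp, (List.isChain_map _).2 (List.Pairwise.isChain (hl.imp ?_))⟩
  intro i j _ x hx y hy h
  simp only [List.getLast?_cons_cons, List.getLast?_singleton, Option.mem_some,
    List.head?_cons] at hx hy
  subst hx hy
  simp at h

variable (i : Fin g)

/-- The order `l₂ ++ l₁` comes from rotating the relator cyclically so that the handle `i` is in
front. -/
theorem exists_orientableSurfaceRelator_eq : ∃ l₁ l₂ : List (Fin g),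
    orientableSurfaceRelator g = commutatorWord l₁ ++ commutatorWord [i] ++ commutatorWord l₂ ∧
      (l₂ ++ l₁).Nodup ∧ i ∉ l₂ ++ l₁ ∧ ∀ j, j ≠ i → j ∈ l₂ ++ l₁ := by
  obtain ⟨l₁, l₂, h⟩ := List.append_of_mem (List.mem_finRange i)
  refine ⟨l₁, l₂, ?_, ?_⟩
  · rw [orientableSurfaceRelator, h]
    simp [commutatorWord]
  · have hperm : (i :: (l₂ ++ l₁)).Perm (List.finRange g) := by
      rw [h]
      exact List.perm_append_comm (l₁ := i :: l₂) (l₂ := l₁)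
    have hnodup := hperm.nodup_iff.2 (List.nodup_finRange g)
    rw [List.nodup_cons] at hnodup
    refine ⟨hnodup.2, hnodup.1, fun j hj => ?_⟩
    exact (List.mem_cons.1 (hperm.mem_iff.2 (List.mem_finRange j))).resolve_left hj

theorem lift_commutatorWord_singleton {K : Type} [Group K] (f : Fin g ⊕ Fin g → K) :
    FreeGroup.lift f (FreeGroup.mk (commutatorWord [i])) =
      f (Sum.inl i) * f (Sum.inr i) * (f (Sum.inl i))⁻¹ * (f (Sum.inr i))⁻¹ := by
  simp [commutatorWord, FreeGroup.lift_mk, mul_assoc]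

/-- Decidability for a set of letters that misses a letter of an orientable surface group. -/
theorem decidableMembership_orientable {X : Set ((Fin g ⊕ Fin g) × Bool)}
    {a : Fin g ⊕ Fin g} {η : Bool} (hX : (a, !η) ∉ X) :
    OneRelatorGroup.DecidableMembership (orientableSurfaceRelator g)
      (Submonoid.closure ((fun x =>
        OneRelatorGroup.ofWord (orientableSurfaceRelator g) [x]) '' X)) := by
  have hcomm : ∀ l₁ l₂ : List (Fin g),
      commutatorWord (l₁ ++ l₂) = commutatorWord l₁ ++ commutatorWord l₂ :=
    fun l₁ l₂ => List.flatMap_append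
  obtain ⟨i, rfl⟩ | ⟨i, rfl⟩ : (∃ i, a = Sum.inl i) ∨ ∃ i, a = Sum.inr i := by
    rcases a with i | i
    exacts [Or.inl ⟨i, rfl⟩, Or.inr ⟨i, rfl⟩]
  all_goals
    obtain ⟨l₁, l₂, hr, hnodup, hi, hmem⟩ := exists_orientableSurfaceRelator_eq i
    have havoid : ∀ x ∈ commutatorWord (l₂ ++ l₁), x.1 ≠ Sum.inl i ∧ x.1 ≠ Sum.inr i := by
      intro x hx
      obtain ⟨j, hj, hxj⟩ := mem_commutatorWord hx
      have hji : j ≠ i := fun h => hi (h ▸ hj)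
      rcases hxj with h | h <;> simp [h, hji]
    have hall : ∀ x : (Fin g ⊕ Fin g) × Bool, x.1 ≠ Sum.inl i → x.1 ≠ Sum.inr i →
        x ∈ commutatorWord (l₂ ++ l₁) := by
      rintro ⟨j | j, b⟩ h1 h2
      · exact (mem_commutatorWord_of_mem (hmem j (by simpa using h1)) b).1
      · exact (mem_commutatorWord_of_mem (hmem j (by simpa using h2)) b).2
    have hred := isReduced_commutatorWord hnodup
  -- With `u`, `v` the products over `l₁`, `l₂`, the relation reads `aᵢ bᵢ = (v u)⁻¹ bᵢ aᵢ`, so for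
  -- `t = aᵢ` the word `p` is the inverse of that for `l₂ ++ l₁`.
  · have hinv : ∀ x ∈ FreeGroup.invRev (commutatorWord (l₂ ++ l₁)),
        x.1 ≠ Sum.inl i ∧ x.1 ≠ Sum.inr i := by
      intro x hx
      simp only [FreeGroup.invRev, List.mem_reverse, List.mem_map] at hx
      obtain ⟨y, hy, rfl⟩ := hx
      exact havoid y hy
    refine decidableMembership_of_hnn (t := Sum.inl i) (s := Sum.inr i) (by simp)
      (p := FreeGroup.invRev (commutatorWord (l₂ ++ l₁)))
      (powersReduced_concat hred.invRev fun x hx => (hinv x hx).2) (fun x hx => (hinv x hx).1)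
      (fun x hx => (hinv x hx).2) ?_ (fun x h1 h2 => ?_) (fun K _ f => ?_) hX
    · refine List.nodup_reverse.2 ((nodup_commutatorWord hnodup).map fun x y h => ?_)
      simpa [Prod.ext_iff] using h
    · refine List.mem_reverse.2 (List.mem_map.2 ⟨(x.1, !x.2), hall _ h1 h2, by simp⟩)
    · rw [hr, ← FreeGroup.mul_mk, ← FreeGroup.mul_mk, map_mul, map_mul,
        lift_commutatorWord_singleton, ← FreeGroup.inv_mk, hcomm, ← FreeGroup.mul_mk, map_inv,
        map_mul]
      generalize FreeGroup.lift f (FreeGroup.mk (commutatorWord l₁)) = u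
      generalize FreeGroup.lift f (FreeGroup.mk (commutatorWord l₂)) = v
      rw [mul_eq_one_iff_eq_inv, ← eq_inv_mul_iff_mul_eq, mul_inv_eq_iff_eq_mul,
        mul_inv_eq_iff_eq_mul, mul_inv_rev]
  -- The same relation, solved for `bᵢ aᵢ = v u aᵢ bᵢ`.
  · refine decidableMembership_of_hnn (t := Sum.inr i) (s := Sum.inl i) (by simp)
      (p := commutatorWord (l₂ ++ l₁))
      (powersReduced_concat hred fun x hx => (havoid x hx).1) (fun x hx => (havoid x hx).2)
      (fun x hx => (havoid x hx).1) (nodup_commutatorWord hnodup)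
      (fun x h1 h2 => hall x h2 h1) (fun K _ f => ?_) hX
    rw [hr, ← FreeGroup.mul_mk, ← FreeGroup.mul_mk, map_mul, map_mul,
      lift_commutatorWord_singleton, hcomm, ← FreeGroup.mul_mk, map_mul]
    generalize FreeGroup.lift f (FreeGroup.mk (commutatorWord l₁)) = u
    generalize FreeGroup.lift f (FreeGroup.mk (commutatorWord l₂)) = v
    rw [mul_eq_one_iff_eq_inv, ← eq_inv_mul_iff_mul_eq, mul_inv_eq_iff_eq_mul,
      mul_inv_eq_iff_eq_mul, ← mul_inv_rev, mul_assoc, mul_assoc (v * u), eq_inv_mul_iff_mul_eq,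
      eq_comm]

end Orientable

/-! ### Adjoining a square root to a free group. -/

section SquareRoot

variable {A : Type} [DecidableEq A]

/-- The free group on `A` with a square root `none` of `z` adjoined. -/
abbrev RootGroup (z : GroupWord A) : Type :=
  PresentedGroup {FreeGroup.of (none : Option A) * FreeGroup.of none *
    (FreeGroup.map some (FreeGroup.mk z))⁻¹}

/-- The map of the free group on `A` to `RootGroup z`. -/
def rootBase (z : GroupWord A) : FreeGroup A →* RootGroup z :=
  (PresentedGroup.mk _).comp (FreeGroup.map some)

/-- The square root of `z`. -/
def root (z : GroupWord A) : RootGroup z := PresentedGroup.of none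

theorem root_mul_root (z : GroupWord A) : root z * root z = rootBase z (FreeGroup.mk z) := by
  have h := PresentedGroup.one_of_mem (rels := {FreeGroup.of (none : Option A) *
    FreeGroup.of none * (FreeGroup.map some (FreeGroup.mk z))⁻¹}) (Set.mem_singleton _)
  rw [map_mul, map_inv, mul_inv_eq_one, map_mul] at h
  exact h

/-- The data of the group in which the letter `(a, η)` is a square root of `z`. -/
def rootData (a : A) (η : Bool) (z : GroupWord A) : StableData A Unit where
  letter x := if x.1 = a then
    (if x.2 = η then some ([], ()) else some (FreeGroup.invRev z, ())) else none
  dom _ := z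
  cod _ := z
  opp := id
  fold _ := z

section Permutations

variable {F : Type} [Group F]

/-- Left multiplication on two copies of a group. -/
def twoCopies : F →* Equiv.Perm (F × Bool) where
  toFun f := (Equiv.mulLeft f).prodCongr (Equiv.refl Bool)
  map_one' := by ext x <;> simp
  map_mul' f f' := by ext x <;> simp [mul_assoc]

/-- A square root of the multiplication by `z` on two copies of a group. -/
def swapCopies (z : F) : Equiv.Perm (F × Bool) where
  toFun x := bif x.2 then (z * x.1, false) else (x.1, true)
  invFun x := bif x.2 then (x.1, false) else (z⁻¹ * x.1, true)
  left_inv := by rintro ⟨x, _ | _⟩ <;> simp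
  right_inv := by rintro ⟨x, _ | _⟩ <;> simp

theorem twoCopies_injective : Function.Injective (twoCopies : F →* _) := by
  intro f f' h
  simpa [twoCopies] using DFunLike.congr_fun h (1, false)

theorem swapCopies_mul_self (z : F) : swapCopies z * swapCopies z = twoCopies z := by
  ext ⟨x, _ | _⟩ <;> simp [swapCopies, twoCopies]

/-- Left multiplications preserve each copy, whereas `swapCopies` exchanges them. -/
theorem swapCopies_notMem (z f : F) :
    swapCopies f ∉ Subgroup.zpowers (twoCopies z : Equiv.Perm (F × Bool)) := by
  rintro ⟨n, hn⟩
  have h : twoCopies (z ^ n) = swapCopies f := (map_zpow _ _ _).trans hn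
  simpa [twoCopies, swapCopies] using DFunLike.congr_fun h (1, false)

end Permutations

/-- An HNN extension that contains `RootGroup z`. -/
abbrev RootHNN (z : GroupWord A) : Type :=
  HNNExtension (Equiv.Perm (FreeGroup A × Bool))
    (Subgroup.zpowers (twoCopies (FreeGroup.mk z))) (Subgroup.zpowers (twoCopies (FreeGroup.mk z)))
    (MulEquiv.refl _)

/-- The usual realization of an amalgam inside an HNN extension: the stable letter commutes with
`z`, and conjugation by it makes the square root `swapCopies` of `z` independent of the base. Normal
forms of `RootGroup z` can then be compared through Britton's lemma in `RootHNN z`. -/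
theorem exists_hom_rootHNN (z : GroupWord A) : ∃ Θ : RootGroup z →* RootHNN z,
    (∀ g, Θ (rootBase z g) = HNNExtension.of (twoCopies g)) ∧
      Θ (root z) = HNNExtension.t * HNNExtension.of (swapCopies (FreeGroup.mk z)) *
        HNNExtension.t⁻¹ := by
  set f : Option A → RootHNN z := fun x => x.elim
    (HNNExtension.t * HNNExtension.of (swapCopies (FreeGroup.mk z)) * HNNExtension.t⁻¹)
    (fun x => HNNExtension.of (twoCopies (FreeGroup.of x))) with hf
  have hbase : ∀ g : FreeGroup A,
      FreeGroup.lift f (FreeGroup.map some g) = HNNExtension.of (twoCopies g) := by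
    intro g
    have : (FreeGroup.lift f).comp (FreeGroup.map some) =
        (HNNExtension.of (φ := MulEquiv.refl _)).comp twoCopies := by
      ext x
      simp [hf]
    exact DFunLike.congr_fun this g
  have ht : (HNNExtension.t * HNNExtension.of (twoCopies (FreeGroup.mk z)) : RootHNN z) =
      HNNExtension.of (twoCopies (FreeGroup.mk z)) * HNNExtension.t :=
    HNNExtension.t_mul_of (φ := MulEquiv.refl _)
      ⟨twoCopies (FreeGroup.mk z), Subgroup.mem_zpowers _⟩
  have hrel : ∀ r ∈ ({FreeGroup.of (none : Option A) * FreeGroup.of none *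
      (FreeGroup.map some (FreeGroup.mk z))⁻¹} : Set _), FreeGroup.lift f r = 1 := by
    rintro _ rfl
    rw [map_mul, map_inv, hbase, mul_inv_eq_one, map_mul, FreeGroup.lift_apply_of]
    have : f none = HNNExtension.t * HNNExtension.of (swapCopies (FreeGroup.mk z)) *
        HNNExtension.t⁻¹ := rfl
    have hs : (HNNExtension.of (twoCopies (FreeGroup.mk z)) : RootHNN z) =
        HNNExtension.of (swapCopies (FreeGroup.mk z)) *
          HNNExtension.of (swapCopies (FreeGroup.mk z)) :=
      (congrArg HNNExtension.of (swapCopies_mul_self _).symm).trans (map_mul _ _ _)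
    rw [this]
    calc _ = HNNExtension.t * (HNNExtension.of (swapCopies (FreeGroup.mk z)) *
          HNNExtension.of (swapCopies (FreeGroup.mk z))) * HNNExtension.t⁻¹ := by group
      _ = _ := by rw [← hs, ht, mul_inv_cancel_right]
  exact ⟨PresentedGroup.toGroup hrel, hbase, FreeGroup.lift_apply_of⟩

theorem realizes_rootData {z : GroupWord A} (hz : PowersReduced z) (a : A) (η : Bool) :
    (rootData a η z).Realizes (rootBase z) (fun _ => root z) := by
  refine ⟨fun _ => ?_, fun _ => root_mul_root z, ?_, ?_⟩
  · simp only [rootData]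
    rw [← root_mul_root]
    exact (mul_assoc _ _ _).symm
  · rintro _ g ⟨n, rfl⟩
    rcases eq_or_ne z [] with rfl | hne
    -- The empty `z` occurs when there is a single generator; its powers are all trivial, so
    -- exponent `0` serves.
    · exact ⟨0, by simp, by simp [rootData, ← FreeGroup.one_eq_mk]⟩
    · exact ⟨n, hz.natAbs_le_norm_zpow hne n, rfl⟩
  · intro g g' l l' hl hl' heq
    obtain ⟨Θ, hΘ, hΘ'⟩ := exists_hom_rootHNN z
    let C := Subgroup.zpowers (twoCopies (FreeGroup.mk z))
    -- Each root becomes `t σ t⁻¹` with `σ` the swap. The result is reduced in `RootHNN z`, because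
    -- `σ` is not a power of `z` and neither are the inner entries of a reduced sequence.
    let L : List (Unit × FreeGroup A) → List (ℤˣ × Equiv.Perm (FreeGroup A × Bool)) := fun l =>
      l.flatMap fun p => [(1, swapCopies (FreeGroup.mk z)), (-1, twoCopies p.2)]
    have hmem : ∀ g : FreeGroup A, twoCopies g ∈ C → g ∈ Subgroup.zpowers (FreeGroup.mk z) := by
      rintro g ⟨n, hn⟩
      exact ⟨n, twoCopies_injective ((map_zpow _ _ _).trans hn)⟩
    have hchain : ∀ l, (rootData a η z).Reduced l →
        (L l).IsChain (fun a b => a.2 ∈ HNNExtension.toSubgroup C C a.1 → a.1 = b.1) := by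
      intro l
      induction l with
      | nil => exact fun _ => List.isChain_nil
      | cons p l ih =>
        intro hl
        refine List.isChain_cons_cons.2 ⟨fun h => absurd h (swapCopies_notMem _ _), ?_⟩
        rcases l with _ | ⟨q, l⟩
        · exact List.isChain_singleton _
        · refine List.isChain_cons_cons.2 ⟨fun h => ?_, ih hl.tail⟩
          exact absurd (hmem _ h) ((List.isChain_cons_cons.1 hl).1 rfl)
    have hprod : ∀ g l, HNNExtension.of (twoCopies g) *
        ((L l).map fun x => HNNExtension.t ^ (x.1 : ℤ) * HNNExtension.of x.2).prod =
          Θ (StableData.eval (rootBase z) (fun _ => root z) g l) := by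
      intro g l
      rw [StableData.eval, map_mul, hΘ, map_list_prod, List.map_map]
      congr 1
      induction l with
      | nil => rfl
      | cons p l ih =>
        have : L (p :: l) = [(1, swapCopies (FreeGroup.mk z)), (-1, twoCopies p.2)] ++ L l := rfl
        rw [this, List.map_append, List.prod_append, ih, List.map_cons, List.prod_cons]
        simp [hΘ, hΘ', mul_assoc]
    have h := HNNExtension.ReducedWord.map_fst_eq_and_of_prod_eq (MulEquiv.refl C)
      (w₁ := ⟨twoCopies g, _, hchain l hl⟩) (w₂ := ⟨twoCopies g', _, hchain l' hl'⟩) (by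
        simp only [HNNExtension.NormalWord.ReducedWord.prod]
        exact (hprod g l).trans ((congrArg Θ heq).trans (hprod g' l').symm))
    have hlen : l.length = l'.length := by
      have := congrArg List.length h.1
      simpa [L] using this
    refine ⟨?_, ?_, ?_⟩
    · exact List.ext_getElem (by simpa using hlen) fun _ _ _ => rfl
    · rintro rfl
      obtain rfl : l' = [] := List.eq_nil_of_length_eq_zero hlen.symm
      have h0 : (HNNExtension.of (twoCopies g) : RootHNN z) = HNNExtension.of (twoCopies g') := by
        simpa [StableData.eval, hΘ] using congrArg Θ heq
      exact twoCopies_injective (HNNExtension.of_injective _ h0)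
    · intro e he
      rcases l with _ | ⟨p, l⟩
      · simp at he
      · have := h.2 1 (by simp [L])
        refine hmem _ ?_
        rw [map_mul, map_inv]
        exact this

end SquareRoot

/-! ### Relators that define a square root. -/

namespace OneRelatorGroup

variable {A : Type} {r : GroupWord A} {X : Set (A × Bool)}

theorem ofWord_mem_closure {v : GroupWord A} (hv : ∀ x ∈ v, x ∈ X) :
    ofWord r v ∈ Submonoid.closure ((fun x => ofWord r [x]) '' X) := by
  rw [ofWord_eq_prod]
  refine Submonoid.list_prod_mem _ fun h hh => ?_
  obtain ⟨x, hx, rfl⟩ := List.mem_map.1 hh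
  exact Submonoid.subset_closure ⟨x, hv x hx, rfl⟩

theorem ofWord_append (u v : GroupWord A) : ofWord r (u ++ v) = ofWord r u * ofWord r v := by
  simp only [ofWord, ← FreeGroup.mul_mk, map_mul]

theorem ofWord_letter_not (x : A × Bool) : ofWord r [(x.1, !x.2)] = (ofWord r [x])⁻¹ := by
  obtain ⟨x, b⟩ := x
  simp only [ofWord, ← map_inv, FreeGroup.inv_mk]
  rfl

/-- If a trivial word over `X` involves all generators, then `X` generates the whole group as a
monoid. -/
theorem closure_eq_top_of_ofWord_eq_one {v : GroupWord A} (hv : ofWord r v = 1)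
    (hX : ∀ x ∈ v, x ∈ X) (hall : ∀ a, ∃ b, (a, b) ∈ v) :
    Submonoid.closure ((fun x => ofWord r [x]) '' X) = ⊤ := by
  have hinv : ∀ x ∈ v, ofWord r [(x.1, !x.2)] ∈
      Submonoid.closure ((fun x => ofWord r [x]) '' X) := by
    intro x hx
    obtain ⟨p, s, rfl⟩ := List.append_of_mem hx
    -- From `p x s = 1` follows `x⁻¹ = s p`, a product of letters of `X`.
    have h : ofWord r [(x.1, !x.2)] = ofWord r (s ++ p) := by
      rw [ofWord_letter_not, ofWord_append, inv_eq_iff_mul_eq_one]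
      rw [← List.singleton_append, ofWord_append, ofWord_append, mul_eq_one_iff_inv_eq] at hv
      rw [← mul_assoc, ← hv, inv_mul_cancel]
    rw [h]
    exact ofWord_mem_closure fun y hy => hX y (by
      rcases List.mem_append.1 hy with hy | hy <;> simp [hy])
  refine eq_top_iff.2 fun h _ => ?_
  obtain ⟨⟨u⟩, rfl⟩ := PresentedGroup.mk_surjective _ h
  change ofWord r u ∈ _
  rw [ofWord_eq_prod]
  refine Submonoid.list_prod_mem _ fun h hh => ?_
  obtain ⟨⟨a, b⟩, -, rfl⟩ := List.mem_map.1 hh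
  obtain ⟨b', hb'⟩ := hall a
  rcases Bool.eq_or_eq_not b b' with rfl | rfl
  · exact Submonoid.subset_closure ⟨_, hX _ hb', rfl⟩
  · exact hinv _ hb'

end OneRelatorGroup

section SquareRelator

variable {A : Type} [DecidableEq A] [Finite A] [Primcodable A]

/-- Decidability for a relator that says that the letter `(a, η)` is a square root of a word in
the other generators, all with the sign opposite to `η`. -/
theorem decidableMembership_of_root {r : GroupWord A} {a : A} {η : Bool} {z : GroupWord A}
    (hza : ∀ x ∈ z, x.1 ≠ a) (hzs : ∀ x ∈ z, x.2 = !η) (hall : ∀ x, x ≠ a → (x, !η) ∈ z)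
    (hr : ∀ (K : Type) [Group K] (f : A → K), FreeGroup.lift f (FreeGroup.mk r) = 1 ↔
      FreeGroup.lift f (FreeGroup.mk [(a, η)]) * FreeGroup.lift f (FreeGroup.mk [(a, η)]) =
        FreeGroup.lift f (FreeGroup.mk z))
    {X : Set (A × Bool)} (hX : (a, !η) ∉ X) :
    OneRelatorGroup.DecidableMembership r
      (Submonoid.closure ((fun x => OneRelatorGroup.ofWord r [x]) '' X)) := by
  classical
  have hz : PowersReduced z := powersReduced_of_sign hzs
  have hrG : OneRelatorGroup.ofWord r [(a, η)] * OneRelatorGroup.ofWord r [(a, η)] =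
      OneRelatorGroup.ofWord r z := by
    have := (hr _ (fun x => (PresentedGroup.of x : OneRelatorGroup r))).1
      ((OneRelatorGroup.lift_of_mk r).trans OneRelatorGroup.ofWord_self)
    simpa only [OneRelatorGroup.lift_of_mk] using this
  -- In this case every letter of the trivial word `a^η a^η z⁻¹` is in `X`, and the word involves
  -- all generators.
  by_cases htop : (a, η) ∈ X ∧ ∀ x ∈ z, (x.1, η) ∈ X
  · have hinv : OneRelatorGroup.ofWord r (FreeGroup.invRev z) =
        (OneRelatorGroup.ofWord r z)⁻¹ := by
      simp only [OneRelatorGroup.ofWord, ← FreeGroup.inv_mk, map_inv]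
    have hmem : ∀ x, x ∈ FreeGroup.invRev z ↔ (x.1, !x.2) ∈ z := by
      intro x
      simp only [FreeGroup.invRev, List.mem_reverse, List.mem_map]
      constructor
      · rintro ⟨y, hy, rfl⟩
        simpa using hy
      · exact fun hx => ⟨_, hx, by simp⟩
    rw [OneRelatorGroup.closure_eq_top_of_ofWord_eq_one
      (v := [(a, η)] ++ [(a, η)] ++ FreeGroup.invRev z)]
    · exact PrimrecPred.computablePred ((PrimrecPred.of_eq
        (p := fun _ => True) ⟨fun _ => isTrue trivial, Primrec.const true⟩) fun u => by simp)
    · rw [OneRelatorGroup.ofWord_append, OneRelatorGroup.ofWord_append, hinv, hrG,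
        mul_inv_cancel]
    · intro x hx
      rcases List.mem_append.1 hx with hx | hx
      · have : x = (a, η) := by simpa using hx
        exact this ▸ htop.1
      · have hx' := (hmem x).1 hx
        have h1 := htop.2 _ hx'
        have h2 : x.2 = η := by simpa using hzs _ hx'
        rwa [← h2] at h1
    · intro x
      refine ⟨η, ?_⟩
      by_cases hx : x = a
      · simp [hx]
      · exact List.mem_append_right _ ((hmem _).2 (hall x hx))
  have hS := realizes_rootData hz a η
  set f : A → RootGroup z := fun x =>
    if x = a then (bif η then root z else (root z)⁻¹) else rootBase z (FreeGroup.of x) with hf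
  have hfa : FreeGroup.lift f (FreeGroup.mk [(a, η)]) = root z := by
    cases η <;> simp [FreeGroup.lift_mk, hf]
  have hfa' : FreeGroup.lift f (FreeGroup.mk [(a, !η)]) = (root z)⁻¹ := by
    cases η <;> simp [FreeGroup.lift_mk, hf]
  have hlift : ∀ w : GroupWord A, (∀ x ∈ w, x.1 ≠ a) →
      FreeGroup.lift f (FreeGroup.mk w) = rootBase z (FreeGroup.mk w) :=
    fun w hw => lift_mk_congr fun x hx => if_neg (hw x hx)
  have hfr : FreeGroup.lift f (FreeGroup.mk r) = 1 := by
    rw [hr, hfa, hlift z hza, root_mul_root]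
  have hρrel : ∀ r' ∈ ({FreeGroup.of (none : Option A) * FreeGroup.of none *
      (FreeGroup.map some (FreeGroup.mk z))⁻¹} : Set _),
      FreeGroup.lift (fun x : Option A => x.elim (OneRelatorGroup.ofWord r [(a, η)])
        (fun x => (PresentedGroup.of x : OneRelatorGroup r))) r' = 1 := by
    rintro _ rfl
    rw [map_mul, map_inv, mul_inv_eq_one, map_mul, FreeGroup.lift_apply_of, Option.elim_none, hrG,
      ← OneRelatorGroup.lift_of_mk, FreeGroup.map.mk, FreeGroup.lift_mk, FreeGroup.lift_mk,
      List.map_map]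
    rfl
  let ρ : RootGroup z →* OneRelatorGroup r := PresentedGroup.toGroup hρrel
  have hρroot : ρ (root z) = OneRelatorGroup.ofWord r [(a, η)] := PresentedGroup.toGroup.of _
  have hρ : ∀ x, ρ (f x) = PresentedGroup.of x := by
    intro x
    by_cases hx : x = a
    · subst hx
      cases η
      · have h1 := OneRelatorGroup.ofWord_letter_not (r := r) (x, false)
        simp only [hf, if_true, cond_false, map_inv, hρroot]
        exact h1.symm
      · simp only [hf, if_true, cond_true, hρroot]
        rfl
    · simp only [hf, if_neg hx]
      have : rootBase z (FreeGroup.of x) = PresentedGroup.of (some x) := rfl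
      rw [this]
      exact PresentedGroup.toGroup.of _
  have hval : ∀ x : A × Bool, x.1 ≠ a →
      (rootData a η z).letterValue (rootBase z) (fun _ => root z) x =
        rootBase z (FreeGroup.mk [x]) := by
    intro x hx
    simp [StableData.letterValue, rootData, hx]
  have hvala : (rootData a η z).letterValue (rootBase z) (fun _ => root z) (a, η) = root z := by
    simp [StableData.letterValue, rootData, ← FreeGroup.one_eq_mk]
  refine OneRelatorGroup.decidableMembership_of_hom hfr ρ hρ
    (v := (rootData a η z).letterValue (rootBase z) (fun _ => root z)) ?_ ?_
  · rintro ⟨x, b⟩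
    by_cases hx : x = a
    · subst hx
      rcases Bool.eq_or_eq_not b η with rfl | rfl
      · rw [hfa, hvala]
      · rw [hfa', eq_inv_iff_mul_eq_one]
        simp only [StableData.letterValue, rootData, if_true, Bool.not_eq_self, if_false]
        rw [mul_assoc, root_mul_root, ← map_mul, ← FreeGroup.inv_mk, inv_mul_cancel, map_one]
    · rw [hlift _ (by simpa using hx), hval _ hx]
  set Y : Set (A × Bool) := {x | x ∈ X ∧ x.1 ≠ a} with hYdef
  have hstable : ∀ x ∈ X, ∀ q e, (rootData a η z).letter x = some (q, e) →
      q = [] ∧ (a, η) ∈ X := by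
    rintro ⟨x, b⟩ hx q e hxl
    by_cases hxa : x = a
    · subst hxa
      rcases Bool.eq_or_eq_not b η with rfl | rfl
      · simp only [rootData, if_true, Option.some.injEq, Prod.mk.injEq] at hxl
        exact ⟨hxl.1.symm, hx⟩
      · exact absurd hx hX
    · simp [rootData, hxa] at hxl
  have hletters : ∀ x ∈ X, (rootData a η z).letter x = none → x ∈ Y := by
    refine fun x hx hxl => ⟨hx, fun h => ?_⟩
    simp only [rootData, h, if_true] at hxl
    split_ifs at hxl
  have hYM : ∀ y ∈ Y, rootBase z (FreeGroup.mk [y]) ∈ Submonoid.closure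
      ((rootData a η z).letterValue (rootBase z) (fun _ => root z) '' X) :=
    fun y hy => Submonoid.subset_closure ⟨y, hy.1, hval y hy.2⟩
  by_cases haX : (a, η) ∈ X
  · have hroot : root z ∈ Submonoid.closure
        ((rootData a η z).letterValue (rootBase z) (fun _ => root z) '' X) :=
      Submonoid.subset_closure ⟨_, haX, hvala⟩
    -- Failure of `htop` provides a letter of `z` whose inverse is missing from `Y`. This is what
    -- the block description of `adjoinWord Y z` needs, and it also bounds the shifts.
    have hY : ∃ x ∈ z, (x.1, !!η) ∉ Y := by
      push Not at htop
      obtain ⟨x, hx, hxX⟩ := htop haX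
      exact ⟨x, hx, fun h => hxX (by simpa using h.1)⟩
    obtain ⟨L, hLp, hL⟩ := exists_primrec_mem_adjoinWord hzs hY
    refine hS.primrecPred_mem_closure (P := fun _ => true) (N := adjoinWord Y z) ?_ ?_ ?_ ?_ ?_ ?_
      hLp hL
    · exact fun x hx hxl => mk_mem_adjoinWord (by simpa using hletters x hx hxl)
    · exact fun x hx q e hxl => ⟨(hstable x hx q e hxl).1, rfl⟩
    · exact fun e _ _ n hn => Submonoid.mul_mem _ hn self_mem_adjoinWord
    · intro y hy
      have : adjoinWord Y z ≤ (Submonoid.closure ((rootData a η z).letterValue (rootBase z)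
          (fun _ => root z) '' X)).comap (rootBase z) := by
        rw [adjoinWord, Submonoid.closure_le]
        rintro _ (⟨y, hy, rfl⟩ | rfl)
        · exact hYM y hy
        · rw [SetLike.mem_coe, Submonoid.mem_comap, ← root_mul_root]
          exact Submonoid.mul_mem _ hroot hroot
      exact this hy
    · exact fun _ _ => hroot
    · intro h l B hB hsh
      obtain ⟨x, hx, hxY⟩ := hY
      rw [Bool.not_not] at hxY
      have h0 : z.count (x.1, η) = 0 :=
        List.count_eq_zero.2 fun h => by simpa using hzs _ h
      have h1 : 1 ≤ z.count (x.1, !η) :=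
        List.count_pos_iff.2 (hzs x hx ▸ hx)
      -- The missing inverse letter occurs neither in `Y` nor in `z`, so `N` avoids it, while it
      -- occurs in every negative power of `z`. Since `dom = cod = z`, applying this to `n` and `-n`
      -- covers both signs.
      refine hsh.bounded (x := (x.1, η)) ?_ (Or.inr (Or.inr fun e _ n => ⟨rfl, ?_⟩)) hB
      · refine fun y hy => letterCount_eq_zero_of_mem_closure ?_ hy
        rintro _ (⟨y, hy, rfl⟩ | rfl)
        · refine Nat.le_zero.1 ((letterCount_mk_le _ _).trans (Nat.le_zero.2 ?_))
          refine List.count_eq_zero.2 fun h => hxY ?_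
          rwa [List.mem_singleton.1 h]
        · exact Nat.le_zero.1 ((letterCount_mk_le _ _).trans h0.le)
      · simp only [rootData, hz.letterCount_zpow, h0, mul_zero, zero_add, neg_neg]
        have h2 := Nat.le_mul_of_pos_right (-n).toNat h1
        have h3 := Nat.le_mul_of_pos_right n.toNat h1
        rw [le_max_iff]
        omega
  -- Without the stable letter, the submonoid lies in the free base group and no shift ever arises.
  · have hYp : PrimrecPred fun w : GroupWord A => ∀ x ∈ w, x ∈ Y :=
      PrimrecPred.forall_mem_list ⟨Classical.decPred _, Primrec.dom_finite _⟩
    refine hS.primrecPred_mem_closure (P := fun _ => false)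
      (N := Submonoid.closure ((fun x => FreeGroup.mk [x]) '' Y))
      (L := fun w => decide (∀ x ∈ w, x ∈ Y)) ?_ ?_ ?_ ?_ ?_ ?_ hYp.decide ?_
    · exact fun x hx hxl => Submonoid.subset_closure ⟨x, hletters x hx hxl, rfl⟩
    · exact fun x hx q e hxl => absurd (hstable x hx q e hxl).2 haX
    · intro _ h
      simp at h
    · intro y hy
      have : Submonoid.closure ((fun x => FreeGroup.mk [x]) '' Y) ≤
          (Submonoid.closure ((rootData a η z).letterValue (rootBase z)
            (fun _ => root z) '' X)).comap (rootBase z) := by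
        rw [Submonoid.closure_le]
        rintro _ ⟨y, hy, rfl⟩
        exact hYM y hy
      exact this hy
    · intro _ h
      simp at h
    · rintro h (_ | ⟨p, l⟩) B _ hsh
      · exact hsh
      · exact absurd hsh.1 (by simp)
    · intro w
      rw [decide_eq_true_iff, mem_closure_letters_iff, FreeGroup.toWord_mk]

end SquareRelator

/-! ### Nonorientable surface groups. -/

section Nonorientable

variable {g : ℕ}

/-- The product of the squares of the generators in `l`. -/
def squareWord (l : List (Fin g)) : GroupWord (Fin g) :=
  l.flatMap fun i => [(i, true), (i, true)]

theorem mem_squareWord_iff {l : List (Fin g)} {x : Fin g × Bool} :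
    x ∈ squareWord l ↔ x.1 ∈ l ∧ x.2 = true := by
  obtain ⟨x, b⟩ := x
  simp only [squareWord, List.mem_flatMap, List.mem_cons, List.not_mem_nil, or_false, or_self,
    Prod.mk.injEq]
  exact ⟨fun ⟨i, hi, h, hb⟩ => ⟨h ▸ hi, hb⟩, fun ⟨hx, hb⟩ => ⟨x, hx, rfl, hb⟩⟩

/-- Decidability for a set of letters that misses a letter of a nonorientable surface group. -/
theorem decidableMembership_nonorientable {X : Set (Fin g × Bool)} {a : Fin g} {η : Bool}
    (hX : (a, !η) ∉ X) :
    OneRelatorGroup.DecidableMembership (nonorientableSurfaceRelator g)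
      (Submonoid.closure ((fun x =>
        OneRelatorGroup.ofWord (nonorientableSurfaceRelator g) [x]) '' X)) := by
  obtain ⟨l₁, l₂, h⟩ := List.append_of_mem (List.mem_finRange a)
  have hr : nonorientableSurfaceRelator g =
      squareWord l₁ ++ ([(a, true)] ++ [(a, true)]) ++ squareWord l₂ := by
    rw [nonorientableSurfaceRelator, h]
    simp [squareWord]
  have hperm : (a :: (l₂ ++ l₁)).Perm (List.finRange g) := by
    rw [h]
    exact List.perm_append_comm (l₁ := a :: l₂) (l₂ := l₁)
  have hnodup := hperm.nodup_iff.2 (List.nodup_finRange g)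
  rw [List.nodup_cons] at hnodup
  have hmem : ∀ x, x ≠ a → x ∈ l₂ ++ l₁ := fun x hx =>
    (List.mem_cons.1 (hperm.mem_iff.2 (List.mem_finRange x))).resolve_left hx
  have hrK : ∀ (K : Type) [Group K] (f : Fin g → K),
      FreeGroup.lift f (FreeGroup.mk (nonorientableSurfaceRelator g)) = 1 ↔
        (f a * f a)⁻¹ = FreeGroup.lift f (FreeGroup.mk (squareWord (l₂ ++ l₁))) := by
    intro K _ f
    have happ : squareWord (l₂ ++ l₁) = squareWord l₂ ++ squareWord l₁ := List.flatMap_append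
    have ha : FreeGroup.mk [(a, true)] = FreeGroup.of a := rfl
    rw [hr, happ, ← FreeGroup.mul_mk, ← FreeGroup.mul_mk, ← FreeGroup.mul_mk, ← FreeGroup.mul_mk,
      ha]
    simp only [map_mul, FreeGroup.lift_apply_of]
    generalize FreeGroup.lift f (FreeGroup.mk (squareWord l₁)) = u
    generalize FreeGroup.lift f (FreeGroup.mk (squareWord l₂)) = v
    rw [mul_eq_one_iff_eq_inv, ← eq_inv_mul_iff_mul_eq, ← mul_inv_rev, ← inv_eq_iff_eq_inv]
  have hsq : ∀ x ∈ squareWord (l₂ ++ l₁), x.1 ≠ a ∧ x.2 = true := fun x hx =>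
    ⟨fun h => hnodup.1 (h ▸ (mem_squareWord_iff.1 hx).1), (mem_squareWord_iff.1 hx).2⟩
  -- If `a` is missing, `a⁻¹` is a square root of the positive word for `l₂ ++ l₁`; if `a⁻¹` is
  -- missing, `a` is a square root of its inverse. Either way the sign of `z` is opposite to `η`.
  cases η
  · refine decidableMembership_of_root (η := false) (z := squareWord (l₂ ++ l₁))
      (fun x hx => (hsq x hx).1)
      (fun x hx => (hsq x hx).2) (fun x hx => mem_squareWord_iff.2 ⟨hmem x hx, rfl⟩)
      (fun K _ f => ?_) hX
    rw [hrK, mul_inv_rev]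
    simp [FreeGroup.lift_mk]
  · have hinv : ∀ x ∈ FreeGroup.invRev (squareWord (l₂ ++ l₁)), x.1 ≠ a ∧ x.2 = false := by
      intro x hx
      simp only [FreeGroup.invRev, List.mem_reverse, List.mem_map] at hx
      obtain ⟨y, hy, rfl⟩ := hx
      simpa using hsq y hy
    refine decidableMembership_of_root (η := true)
      (z := FreeGroup.invRev (squareWord (l₂ ++ l₁)))
      (fun x hx => (hinv x hx).1) (fun x hx => (hinv x hx).2) (fun x hx => ?_)
      (fun K _ f => ?_) hX
    · exact List.mem_reverse.2 (List.mem_map.2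
        ⟨(x, true), mem_squareWord_iff.2 ⟨hmem x hx, rfl⟩, rfl⟩)
    · rw [hrK, ← FreeGroup.inv_mk, map_inv, inv_eq_iff_eq_inv]
      simp [FreeGroup.lift_mk]

end Nonorientable

/-! ### The main theorem. -/

/-- A set that does not contain both `a` and `a⁻¹` misses one of them. -/
theorem exists_letter_notMem {A : Type} {X : Set (A × Bool)} {a : A}
    (h : ¬ ({(a, true), (a, false)} : Set (A × Bool)) ⊆ X) : ∃ η : Bool, (a, !η) ∉ X := by
  by_contra! hX
  refine h ?_
  rintro _ (rfl | rfl)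
  exacts [hX false, hX true]

theorem mainTheorem4 (g : ℕ) :
    (∀ M : Submonoid (OrientableSurfaceGroup g),
      OneRelatorGroup.IsMagnusSubmonoid (orientableSurfaceRelator g) M →
        OneRelatorGroup.DecidableMembership (orientableSurfaceRelator g) M) ∧
    (∀ M : Submonoid (NonorientableSurfaceGroup g),
      OneRelatorGroup.IsMagnusSubmonoid (nonorientableSurfaceRelator g) M →
        OneRelatorGroup.DecidableMembership (nonorientableSurfaceRelator g) M) := by
  constructor
  · rintro M ⟨X, ⟨a, -, ha⟩, rfl⟩
    obtain ⟨η, hη⟩ := exists_letter_notMem ha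
    exact decidableMembership_orientable hη
  · rintro M ⟨X, ⟨a, -, ha⟩, rfl⟩
    obtain ⟨η, hη⟩ := exists_letter_notMem ha
    exact decidableMembership_nonorientable hη
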